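/- For a positive integer $n$ and $p\in[0,1]$, let $G(n,p)$ be the random graph on an $n$-element vertex set in which each pair of distinct vertices is joined by an edge with probability $p$, independently of all other pairs. Let $\mathcal F_n(2)$ be the family of all (simple) graphs on $n$ vertices with maximum degree at most $2$. A graph $G$ is called $\mathcal F_n(2)$-universal if it contains every graph in $\mathcal F_n(2)$ as a (not necessarily induced) subgraph. Theorem. There exists an absolute constant $C>0$ such that the following holds. Let $(p_n)_{n\ge 1}$ be any sequence in $[0,1]$ with $p_n\ge C\big(\frac{\log n}{n}\big)^{1/2}$ for all sufficiently large $n$. Then $G(n,p_n)$ is asymptotically almost surely $\mathcal F_n(2)$-universal, that is, $$\lim_{n\to\infty}\Pr\big[\,G(n,p_n)\text{ is }\mathcal F_n(2)\text{-universal}\,\big]=1 .$$ -/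

import Mathlib

open Filter Topology
open scoped SimpleGraph

/-- The family `𝓕_n(d)` of all graphs on `n` vertices (labelled by `Fin n`) with maximum degree
at most `d`. -/
def boundedDegreeFamily (n d : ℕ) : Set (SimpleGraph (Fin n)) :=
  open Classical in {H | H.maxDegree ≤ d}

/-- A graph `G` is `𝓕`-universal if it contains every graph in the family `𝓕` as a
(not necessarily induced) subgraph. -/
def IsUniversalFor {V W : Type*} (𝓕 : Set (SimpleGraph W)) (G : SimpleGraph V) : Prop :=
  ∀ H ∈ 𝓕, H.IsContained G

/-- For a sequence of edge probabilities `p`, the random graph `G(n, p n)` asymptotically almost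
surely has the property `P`: the probability that `G(n, p n)` has `P n` tends to `1`
as `n → ∞`. -/
def RandomGraphAAS (p : ℕ → unitInterval) (P : (n : ℕ) → SimpleGraph (Fin n) → Prop) : Prop :=
  Tendsto (fun n : ℕ => SimpleGraph.binomialRandom (Fin n) (p n) {G | P n G}) atTop (𝓝 1)

/-! A graph of maximum degree at most 2 lies in a disjoint union of cycles (single edges counting as
2-cycles, single vertices as 1-cycles), that is, in the functional graph of a permutation
(`exists_perm_of_degree_le_two`). Only the cycle type matters, but there are superpolynomially many
of them, while a fixed graph is found only with failure probability polynomial in 1/n. So the union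
bound is taken over polynomially many richer host graphs.

A host, or piece, has `m k` cycles of each length k < 72 and one chain of blocks in which
consecutive segments close up to cycles. A block has 8 vertices and there is about one optional
vertex `z` per block, so 9 vertices are used per block; the two possible places of each `z` let a
segment attain any prescribed length that is at least 72 = 8 * 9. Hence all cycle types with the
same short counts and the same total long length share one host (`exists_cover`), and at most (n +
1)^74 hosts occur.

Each host splits into 72 layers such that every vertex has at most two lower neighbours, and these
sets are disjoint within a layer. Write G(n, p) as a union of 72 independent copies of G(n, q) and
embed one layer per copy. By Hall's theorem, a layer fails to extend with probability at most N^3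
exp(-q^2 N / 2), where N is the number of unused vertices
(`binomialRandom_real_not_exists_injective_le`). The top layer holds a positive fraction of all
vertices, so N stays linear in n and the failure probability beats (n + 1)^74. -/

/-! ### Graphs of maximum degree two inside permutations -/

/-- A finite graph in which no vertex has three neighbours is contained in the functional graph
of a permutation that fixes all isolated vertices. -/
theorem exists_perm_of_degree_le_two {V : Type*} [Finite V] (H : SimpleGraph V)
    (hdeg : ∀ v a b c, H.Adj v a → H.Adj v b → H.Adj v c → a = b ∨ b = c ∨ a = c) :
    ∃ σ : Equiv.Perm V, (∀ u v, H.Adj u v → σ u = v ∨ σ v = u) ∧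
      ∀ v, (∀ u, ¬ H.Adj v u) → σ v = v := by
  classical
  induction hm : H.edgeSet.ncard using Nat.strong_induction_on generalizing H with
  | _ m ih =>
  by_cases hA : ∃ v a b, a ≠ b ∧ H.Adj v a ∧ H.Adj v b
  · obtain ⟨v, a, b, hab, hva, hvb⟩ := hA
    have nva := hva.ne
    have nvb := hvb.ne
    -- If a and b are adjacent, the degree bound makes v, a, b a whole component; it is deleted and
    -- restored as a 3-cycle.
    by_cases hadj : H.Adj a b
    · let H' : SimpleGraph V :=
        { Adj := fun x y => H.Adj x y ∧ x ≠ v ∧ x ≠ a ∧ x ≠ b ∧ y ≠ v ∧ y ≠ a ∧ y ≠ b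
          symm := ⟨fun x y h => ⟨h.1.symm, by tauto⟩⟩
          loopless := ⟨fun x h => h.1.ne rfl⟩ }
      have hlt : H'.edgeSet.ncard < m := by
        rw [← hm]
        refine Set.ncard_lt_ncard ?_ (Set.toFinite _)
        refine SimpleGraph.edgeSet_ssubset_edgeSet.2 (lt_of_le_of_ne (fun x y h => h.1) ?_)
        intro h
        have : H'.Adj v a := h ▸ hva
        exact this.2.1 rfl
      obtain ⟨σ, h1, h2⟩ := ih _ hlt H'
        (fun v a b c h1 h2 h3 => hdeg v a b c h1.1 h2.1 h3.1) rfl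
      have fv : σ v = v := h2 v fun u h => h.2.1 rfl
      have fa : σ a = a := h2 a fun u h => h.2.2.1 rfl
      have fb : σ b = b := h2 b fun u h => h.2.2.2.1 rfl
      have nv : ∀ x, H.Adj v x → x = a ∨ x = b := fun x hx => by
        have := hdeg v a b x hva hvb hx; tauto
      have na : ∀ x, H.Adj a x → x = v ∨ x = b := fun x hx => by
        have := hdeg a v b x hva.symm hadj hx; tauto
      have nb : ∀ x, H.Adj b x → x = v ∨ x = a := fun x hx => by
        have := hdeg b v a x hvb.symm hadj.symm hx; tauto
      have key : ∀ x, x ≠ v → x ≠ a → x ≠ b →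
          (σ * (Equiv.swap v a * Equiv.swap a b)) x = σ x := fun x h1 h2 h3 => by
        simp [Equiv.swap_apply_of_ne_of_ne, h1, h2, h3]
      have kv : (σ * (Equiv.swap v a * Equiv.swap a b)) v = a := by
        simp [Equiv.swap_apply_of_ne_of_ne, nva, nvb, fa]
      have ka : (σ * (Equiv.swap v a * Equiv.swap a b)) a = b := by
        simp [Equiv.swap_apply_of_ne_of_ne, nvb.symm, hab.symm, fb]
      have kb : (σ * (Equiv.swap v a * Equiv.swap a b)) b = v := by
        simp [fv]
      refine ⟨σ * (Equiv.swap v a * Equiv.swap a b), ?_, ?_⟩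
      · intro x y hxy
        by_cases hx : x = v ∨ x = a ∨ x = b
        · rcases hx with rfl | rfl | rfl
          · rcases nv y hxy with rfl | rfl <;> tauto
          · rcases na y hxy with rfl | rfl <;> tauto
          · rcases nb y hxy with rfl | rfl <;> tauto
        · by_cases hy : y = v ∨ y = a ∨ y = b
          · rcases hy with rfl | rfl | rfl
            · rcases nv x hxy.symm with rfl | rfl <;> tauto
            · rcases na x hxy.symm with rfl | rfl <;> tauto
            · rcases nb x hxy.symm with rfl | rfl <;> tauto
          · push Not at hx hy
            rw [key x hx.1 hx.2.1 hx.2.2, key y hy.1 hy.2.1 hy.2.2]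
            exact h1 x y ⟨hxy, hx.1, hx.2.1, hx.2.2, hy⟩
      · intro x hx
        have e1 : x ≠ v := by rintro rfl; exact hx _ hva
        have e2 : x ≠ a := by rintro rfl; exact hx _ hadj
        have e3 : x ≠ b := by rintro rfl; exact hx _ hadj.symm
        rw [key x e1 e2 e3]
        exact h2 x fun u h => hx u h.1
    -- Otherwise v is suppressed: the path a v b becomes an edge a b, which saves one edge. In `H'`
    -- the vertex v is isolated, hence fixed by the permutation, and can be spliced in between a and
    -- b.
    · let H' : SimpleGraph V :=
        { Adj := fun x y => (H.Adj x y ∧ x ≠ v ∧ y ≠ v) ∨ (x = a ∧ y = b) ∨ (x = b ∧ y = a)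
          symm := ⟨fun x y h => by have := H.adj_comm x y; tauto⟩
          loopless := ⟨fun x h => by
            rcases h with h | h | h
            · exact h.1.ne rfl
            · exact hab (h.1.symm.trans h.2)
            · exact hab (h.2.symm.trans h.1)⟩ }
      have nv : ∀ x, H.Adj v x → x = a ∨ x = b := fun x hx => by
        have := hdeg v a b x hva hvb hx; tauto
      have hlt : H'.edgeSet.ncard < m := by
        have hsub : H'.edgeSet ⊆ insert s(a, b) (H.edgeSet \ {s(v, a), s(v, b)}) := by
          intro e
          induction e using Sym2.ind with
          | _ x y =>
            simp only [SimpleGraph.mem_edgeSet, Set.mem_insert_iff, Set.mem_sdiff, Sym2.eq_iff,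
              Set.mem_singleton_iff, H']
            tauto
        have h1 : ({s(v, a), s(v, b)} : Set (Sym2 V)) ⊆ H.edgeSet := by
          rintro e (rfl | rfl)
          · exact hva
          · exact hvb
        have h2 : ({s(v, a), s(v, b)} : Set (Sym2 V)).ncard = 2 :=
          Set.ncard_pair (by simp [hab, nvb])
        have h3 := Set.ncard_sdiff_add_ncard_of_subset h1 (Set.toFinite _)
        have h4 := Set.ncard_le_ncard hsub (Set.toFinite _)
        have h5 := Set.ncard_insert_le s(a, b) (H.edgeSet \ {s(v, a), s(v, b)})
        omega
      have hdeg' : ∀ w x y z, H'.Adj w x → H'.Adj w y → H'.Adj w z → x = y ∨ y = z ∨ x = z := by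
        intro w x y z hx hy hz
        have e0 := hdeg w x y z
        have e1 := hdeg w v x y
        have e2 := hdeg w v x z
        have e3 := hdeg w v y z
        have e4 : H.Adj a v := hva.symm
        have e5 : H.Adj b v := hvb.symm
        simp only [H'] at hx hy hz
        grind
      obtain ⟨σ, h1, h2⟩ := ih _ hlt H' hdeg' rfl
      have fv : σ v = v := h2 v fun u h => by simp only [H'] at h; tauto
      have main : ∀ a b : V, a ≠ b → H.Adj v a → H.Adj v b → ¬ H.Adj a b →
          (∀ x, H.Adj v x → x = a ∨ x = b) → σ a = b →
          (∀ x y, H.Adj x y → x ≠ v → y ≠ v → σ x = y ∨ σ y = x) →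
          (∀ x, (∀ u, ¬ H.Adj x u) → σ x = x) →
          ∃ σ : Equiv.Perm V, (∀ u v, H.Adj u v → σ u = v ∨ σ v = u) ∧
            ∀ v, (∀ u, ¬ H.Adj v u) → σ v = v := by
        intro a b hab hva hvb hadj nv hσ g1 g2
        have nva := hva.ne
        have nvb := hvb.ne
        have kv : (Equiv.swap v b * σ) v = b := by simp [fv]
        have ka : (Equiv.swap v b * σ) a = v := by simp [hσ]
        have key : ∀ x, x ≠ v → x ≠ a → (Equiv.swap v b * σ) x = σ x := by
          intro x hx hxa
          rw [Equiv.Perm.mul_apply]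
          refine Equiv.swap_apply_of_ne_of_ne ?_ ?_
          · intro h; exact hx (σ.injective (h.trans fv.symm))
          · intro h; exact hxa (σ.injective (h.trans hσ.symm))
        -- Splicing destroys only the arc from a to b, which is not an edge of `H`.
        have step : ∀ x y, H.Adj x y → x ≠ v → y ≠ v → σ x = y → (Equiv.swap v b * σ) x = y := by
          intro x y hxy hx hy h
          rw [key x hx ?_, h]
          rintro rfl
          exact hadj (by rw [← hσ, h]; exact hxy)
        refine ⟨Equiv.swap v b * σ, ?_, ?_⟩
        · intro x y hxy
          by_cases hx : x = v
          · subst hx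
            rcases nv y hxy with rfl | rfl
            · exact Or.inr ka
            · exact Or.inl kv
          by_cases hy : y = v
          · subst hy
            rcases nv x hxy.symm with rfl | rfl
            · exact Or.inl ka
            · exact Or.inr kv
          rcases g1 x y hxy hx hy with h | h
          · exact Or.inl (step x y hxy hx hy h)
          · exact Or.inr (step y x hxy.symm hy hx h)
        · intro x hx
          rw [key x (by rintro rfl; exact hx _ hva) (by rintro rfl; exact hx _ hva.symm)]
          exact g2 x hx
      have g1 : ∀ x y, H.Adj x y → x ≠ v → y ≠ v → σ x = y ∨ σ y = x :=
        fun x y h hx hy => h1 x y (Or.inl ⟨h, hx, hy⟩)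
      have g2 : ∀ x, (∀ u, ¬ H.Adj x u) → σ x = x := by
        intro x hx
        refine h2 x fun u h => ?_
        rcases h with h | ⟨rfl, -⟩ | ⟨rfl, -⟩
        · exact hx _ h.1
        · exact hx _ hva.symm
        · exact hx _ hvb.symm
      rcases h1 a b (Or.inr (Or.inl ⟨rfl, rfl⟩)) with h | h
      · exact main a b hab hva hvb hadj nv h g1 g2
      · exact main b a hab.symm hvb hva (fun h => hadj h.symm) (fun x hx => (nv x hx).symm) h g1 g2
  · push Not at hA
    have huniq : ∀ v a b, H.Adj v a → H.Adj v b → a = b := fun v a b h1 h2 => by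
      by_contra hne
      exact hA v a b hne h1 h2
    by_cases hE : ∃ u v, H.Adj u v
    · obtain ⟨u, v, huv⟩ := hE
      let H' : SimpleGraph V :=
        { Adj := fun x y => H.Adj x y ∧ x ≠ u ∧ x ≠ v ∧ y ≠ u ∧ y ≠ v
          symm := ⟨fun x y h => ⟨h.1.symm, by tauto⟩⟩
          loopless := ⟨fun x h => h.1.ne rfl⟩ }
      have hlt : H'.edgeSet.ncard < m := by
        rw [← hm]
        refine Set.ncard_lt_ncard ?_ (Set.toFinite _)
        refine SimpleGraph.edgeSet_ssubset_edgeSet.2 (lt_of_le_of_ne (fun x y h => h.1) ?_)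
        intro h
        have : H'.Adj u v := h ▸ huv
        exact this.2.1 rfl
      obtain ⟨σ, h1, h2⟩ := ih _ hlt H'
        (fun v a b c h1 h2 h3 => hdeg v a b c h1.1 h2.1 h3.1) rfl
      have fu : σ u = u := h2 u fun w h => h.2.1 rfl
      have fv : σ v = v := h2 v fun w h => h.2.2.1 rfl
      have ku : (σ * Equiv.swap u v) u = v := by simp [fv]
      have kv : (σ * Equiv.swap u v) v = u := by simp [fu]
      have key : ∀ x, x ≠ u → x ≠ v → (σ * Equiv.swap u v) x = σ x := fun x h1 h2 => by
        simp [Equiv.swap_apply_of_ne_of_ne, h1, h2]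
      refine ⟨σ * Equiv.swap u v, ?_, ?_⟩
      · intro x y hxy
        by_cases hx : x = u
        · subst hx; rw [huniq _ _ _ hxy huv]; exact Or.inl ku
        by_cases hx' : x = v
        · subst hx'; rw [huniq _ _ _ hxy huv.symm]; exact Or.inl kv
        have hy : y ≠ u := by rintro rfl; exact hx' (huniq _ _ _ hxy.symm huv)
        have hy' : y ≠ v := by rintro rfl; exact hx (huniq _ _ _ hxy.symm huv.symm)
        rw [key x hx hx', key y hy hy']
        exact h1 x y ⟨hxy, hx, hx', hy, hy'⟩
      · intro x hx
        rw [key x (by rintro rfl; exact hx _ huv) (by rintro rfl; exact hx _ huv.symm)]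
        exact h2 x fun w h => hx w h.1
    · push Not at hE
      exact ⟨1, fun u v h => absurd h (hE u v), fun _ _ => rfl⟩

/-! ### The ambient layered graph and its closed walks -/

/-- Vertices of an infinite graph out of which universal graphs for cycle lengths are cut:
`short k i j` is the `j`-th vertex of the `i`-th copy of the `k`-cycle, and the other
vertices form a ladder-like chain of blocks `x₀ x₁ x₂ x₃ x₄ / y₀ y₁ y₂`, in which the vertex `z t`
may be inserted either into the edge `x₀ x₁` of block `t` or into the edge `x₂ x₃` of
block `t - 8`. -/
inductive ChainVertex
  | short (k i j : ℕ)
  | x₀ (i : ℕ)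
  | x₁ (i : ℕ)
  | x₂ (i : ℕ)
  | x₃ (i : ℕ)
  | x₄ (i : ℕ)
  | y₀ (i : ℕ)
  | y₁ (i : ℕ)
  | y₂ (i : ℕ)
  | z (i : ℕ)
  deriving DecidableEq

namespace ChainVertex

/-- The neighbours of a vertex in lower layers. -/
def down : ChainVertex → Finset ChainVertex
  | short k i j =>
      if j = 0 ∨ k ≤ j ∨ 72 ≤ k then ∅
      else if j + 1 = k then {short k i (j - 1), short k i 0} else {short k i (j - 1)}
  | x₀ i => {z i}
  | x₁ i => {z i, x₀ i}
  | x₂ i => {z (i + 8), x₁ i}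
  | x₃ i => {z (i + 8), x₂ i}
  | x₄ i => {x₃ i, x₀ (i + 1)}
  | y₀ i => {x₀ i}
  | y₁ i => {y₀ i, y₂ i}
  | y₂ i => {x₄ i, y₀ (i + 1)}
  | z _ => ∅

/-- The layer of a vertex; the top layer `71` holds a vertex of each cycle and of each block. -/
def layer : ChainVertex → ℕ
  | short k _ j => if j + 1 = k then 71 else j
  | x₀ _ => 1
  | x₁ _ => 2
  | x₂ _ => 3
  | x₃ _ => 4
  | x₄ _ => 5
  | y₀ _ => 6
  | y₁ _ => 71
  | y₂ _ => 7
  | z _ => 0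

/-- The guard k < 72 in `down` is needed here: the last vertex of a cycle sits in layer 71, above
all other positions j of a short cycle. -/
theorem layer_lt_of_mem_down {u v : ChainVertex} (h : v ∈ down u) : layer v < layer u := by
  cases u with
  | short k i j =>
    simp only [down] at h
    split_ifs at h with h1 h2
    · simp at h
    · simp only [Finset.mem_insert, Finset.mem_singleton] at h
      rcases h with rfl | rfl <;> simp only [layer] <;> split_ifs <;> omega
    · simp only [Finset.mem_singleton] at h
      subst h
      simp only [layer]
      split_ifs <;> omega
  | z i => simp [down] at h
  | x₀ i | y₀ i =>
    simp only [down, Finset.mem_singleton] at h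
    subst h; simp [layer]
  | x₁ i | x₂ i | x₃ i | x₄ i | y₁ i | y₂ i =>
    simp only [down, Finset.mem_insert, Finset.mem_singleton] at h
    rcases h with rfl | rfl <;> simp [layer]

theorem card_down_le_two (u : ChainVertex) : (down u).card ≤ 2 := by
  cases u with
  | short k i j =>
    simp only [down]
    split_ifs
    · simp
    · exact Finset.card_le_two
    · simp
  | z i => simp [down]
  | x₀ i | y₀ i => simp [down]
  | x₁ i | x₂ i | x₃ i | x₄ i | y₁ i | y₂ i => exact Finset.card_le_two

/-- Within a layer, lower neighbourhoods are disjoint. This makes the edge sets tested for different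
vertices of one layer disjoint, hence independent. -/
theorem eq_of_mem_down {u v w : ChainVertex} (hl : layer u = layer v) (hu : w ∈ down u)
    (hv : w ∈ down v) : u = v := by
  cases u with
  | z i => simp [down] at hu
  | short k i j =>
    cases v with
    | short k' i' j' =>
      simp only [down, layer] at hu hv hl
      split_ifs at hu hv hl <;>
        simp only [Finset.mem_insert, Finset.mem_singleton, Finset.notMem_empty] at hu hv <;>
        first
        | omega
        | (cases w <;> simp_all <;> omega)
    | _ =>
      simp only [down] at hu hv
      split_ifs at hu <;>
        cases w <;>
        simp only [Finset.mem_insert, Finset.mem_singleton, Finset.notMem_empty] at hu hv <;>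
        simp_all
  | _ =>
    cases v with
    | short k' i' j' =>
      simp only [down] at hu hv
      split_ifs at hv <;>
        cases w <;>
        simp only [Finset.mem_insert, Finset.mem_singleton, Finset.notMem_empty] at hu hv <;>
        simp_all
    | _ =>
      simp only [layer] at hl
      first
      | omega
      | (simp only [down, Finset.mem_insert, Finset.mem_singleton] at hu hv
         cases w <;> simp_all)

/-- Adjacency of the graph with lower neighbourhoods `down`. -/
def Adj (u v : ChainVertex) : Prop := u ∈ down v ∨ v ∈ down u

/-- The finite piece with `m k` cycles of length `k < 72`, the first `E` blocks of the chain and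
the first `W` of the insertable vertices. -/
def InPiece (m : ℕ → ℕ) (E W : ℕ) : ChainVertex → Prop
  | short k i j => k < 72 ∧ i < m k ∧ j < k
  | x₀ i => i < E
  | x₁ i => i < E
  | x₂ i => i < E
  | x₃ i => i < E
  | x₄ i => i < E
  | y₀ i => i < E
  | y₁ i => i < E
  | y₂ i => i < E
  | z t => t < W

/-- The part of a cycle along the `x`-side, through the blocks `s, …, s + d - 1`: the vertices
`z t` with `w ≤ t < w'` are inserted. -/
def xSide (e' w w' : ℕ) : ℕ → ℕ → List ChainVertex
  | _, 0 => []
  | s, d + 1 => x₀ s :: ((if w ≤ s then [z s] else []) ++ x₁ s :: x₂ s ::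
      ((if e' ≤ s + 8 ∧ s + 8 < w' then [z (s + 8)] else []) ++
        x₃ s :: x₄ s :: xSide e' w w' (s + 1) d))

/-- The part of a cycle along the `y`-side, backwards. -/
def ySide : ℕ → ℕ → List ChainVertex
  | _, 0 => []
  | s, d + 1 => ySide (s + 1) d ++ [y₂ s, y₁ s, y₀ s]

theorem mem_ySide {s d : ℕ} {v : ChainVertex} : v ∈ ySide s d ↔
    ∃ i, s ≤ i ∧ i < s + d ∧ (v = y₂ i ∨ v = y₁ i ∨ v = y₀ i) := by
  induction d generalizing s with
  | zero => simp only [ySide, List.not_mem_nil, false_iff]; rintro ⟨i, h1, h2, -⟩; omega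
  | succ d ih =>
    simp only [ySide, List.mem_append, ih, List.mem_cons, List.not_mem_nil, or_false]
    constructor
    · rintro (⟨i, h1, h2, h⟩ | h)
      · exact ⟨i, by omega, by omega, h⟩
      · exact ⟨s, le_rfl, by omega, h⟩
    · rintro ⟨i, h1, h2, h⟩
      rcases eq_or_lt_of_le h1 with rfl | h1
      · exact Or.inr h
      · exact Or.inl ⟨i, by omega, by omega, h⟩

theorem mem_xSide {e' w w' s d : ℕ} {v : ChainVertex} : v ∈ xSide e' w w' s d ↔
    ∃ i, s ≤ i ∧ i < s + d ∧ (v = x₀ i ∨ v = x₁ i ∨ v = x₂ i ∨ v = x₃ i ∨ v = x₄ i ∨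
      (w ≤ i ∧ v = z i) ∨ (e' ≤ i + 8 ∧ i + 8 < w' ∧ v = z (i + 8))) := by
  induction d generalizing s with
  | zero => simp only [xSide, List.not_mem_nil, false_iff]; rintro ⟨i, h1, h2, -⟩; omega
  | succ d ih =>
    have e1 : v ∈ (if w ≤ s then [z s] else []) ↔ w ≤ s ∧ v = z s := by split_ifs <;> simp [*]
    have e2 : v ∈ (if e' ≤ s + 8 ∧ s + 8 < w' then [z (s + 8)] else []) ↔
        e' ≤ s + 8 ∧ s + 8 < w' ∧ v = z (s + 8) := by split_ifs <;> simp <;> tauto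
    simp only [xSide, List.mem_append, ih, List.mem_cons, e1, e2]
    constructor
    · rintro (h | h | h | h | h | h | h | ⟨i, h1, h2, h⟩)
      · exact ⟨s, le_rfl, by omega, Or.inl h⟩
      · exact ⟨s, le_rfl, by omega, .inr <| .inr <| .inr <| .inr <| .inr <| .inl h⟩
      · exact ⟨s, le_rfl, by omega, .inr <| .inl h⟩
      · exact ⟨s, le_rfl, by omega, .inr <| .inr <| .inl h⟩
      · exact ⟨s, le_rfl, by omega, .inr <| .inr <| .inr <| .inr <| .inr <| .inr h⟩
      · exact ⟨s, le_rfl, by omega, .inr <| .inr <| .inr <| .inl h⟩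
      · exact ⟨s, le_rfl, by omega, .inr <| .inr <| .inr <| .inr <| .inl h⟩
      · exact ⟨i, by omega, by omega, h⟩
    · rintro ⟨i, h1, h2, h⟩
      rcases eq_or_lt_of_le h1 with rfl | h1
      · rcases h with h | h | h | h | h | h | h
        · exact .inl h
        · exact .inr <| .inr <| .inl h
        · exact .inr <| .inr <| .inr <| .inl h
        · exact .inr <| .inr <| .inr <| .inr <| .inr <| .inl h
        · exact .inr <| .inr <| .inr <| .inr <| .inr <| .inr <| .inl h
        · exact .inr <| .inl h
        · exact .inr <| .inr <| .inr <| .inr <| .inl h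
      · exact .inr <| .inr <| .inr <| .inr <| .inr <| .inr <| .inr ⟨i, by omega, by omega, h⟩

theorem nodup_ySide (s d : ℕ) : (ySide s d).Nodup := by
  induction d generalizing s with
  | zero => simp [ySide]
  | succ d ih =>
    rw [ySide, List.nodup_append']
    refine ⟨ih _, by simp, ?_⟩
    intro v hv hv'
    obtain ⟨i, h1, h2, h⟩ := mem_ySide.1 hv
    simp only [List.mem_cons, List.not_mem_nil, or_false] at hv'
    rcases h with rfl | rfl | rfl <;> simp at hv' <;> omega

/-- A vertex `z t` placed in its own block has t < s + d ≤ e', whereas one placed eight blocks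
earlier has t ≥ e', so none is used twice. -/
theorem nodup_xSide {e' w w' s d : ℕ} (h : s + d ≤ e') : (xSide e' w w' s d).Nodup := by
  induction d generalizing s with
  | zero => simp [xSide]
  | succ d ih =>
    have h0 := ih (s := s + 1) (by omega)
    simp only [xSide]
    split_ifs with h1 h2 h2 <;>
      simp [h0, mem_xSide] <;> grind

theorem length_ySide (s d : ℕ) : (ySide s d).length = 3 * d := by
  induction d generalizing s with
  | zero => simp [ySide]
  | succ d ih => simp [ySide, ih]; ring

/-- Five vertices per block, plus the `z t` with t < e' in their own block and those with t ≥ e' in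
block t - 8. The maxima keep the count valid as s moves up in the induction. -/
theorem length_xSide {e w e' w' d s : ℕ} (hsd : s + d = e') (hes : e ≤ s) (hw : w ≤ w')
    (h2 : w ≤ e') (h3 : w' ≤ e' + 8) :
    (xSide e' w w' s d).length =
      5 * d + (e' - max w s) + (w' - max e' (s + 8)) := by
  induction d generalizing s with
  | zero => simp [xSide]; omega
  | succ d ih =>
    simp only [xSide, List.length_cons, List.length_append, ih (s := s + 1) (by omega) (by omega)]
    split_ifs <;> simp <;> omega

theorem isChain_xSide {e' w w' s d : ℕ} {l : List ChainVertex}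
    (h : (x₄ (s + d) :: l).IsChain Adj) : (xSide e' w w' s (d + 1) ++ l).IsChain Adj := by
  have block : ∀ (s : ℕ) (L : List ChainVertex), (x₄ s :: L).IsChain Adj →
      (x₀ s :: ((if w ≤ s then [z s] else []) ++ x₁ s :: x₂ s ::
      ((if e' ≤ s + 8 ∧ s + 8 < w' then [z (s + 8)] else []) ++
        x₃ s :: x₄ s :: L))).IsChain Adj := by
    intro s L hL
    split_ifs <;> simp [Adj, down, hL]
  induction d generalizing s with
  | zero => simpa [xSide] using block s l h
  | succ d ih =>
    have h1 := ih (s := s + 1) (by rwa [show s + 1 + d = s + (d + 1) by ring])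
    have h2 : (x₄ s :: (xSide e' w w' (s + 1) (d + 1) ++ l)).IsChain Adj := by
      rw [xSide, List.cons_append, List.isChain_cons_cons]
      refine ⟨Or.inr (by simp [down]), ?_⟩
      rwa [xSide, List.cons_append] at h1
    rw [xSide]
    simpa using block s _ h2

theorem isChain_ySide {s d : ℕ} {v : ChainVertex} {l : List ChainVertex}
    (hv : Adj v (y₂ (s + d))) (h : (y₀ s :: l).IsChain Adj) :
    (v :: (ySide s (d + 1) ++ l)).IsChain Adj := by
  induction d generalizing s l with
  | zero => 
    rw [ySide, ySide, List.nil_append, List.cons_append, List.isChain_cons_cons]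
    exact ⟨hv, by simp [Adj, down, h]⟩
  | succ d ih =>
    rw [ySide, List.append_assoc]
    refine ih (by rwa [show s + 1 + d = s + (d + 1) by ring]) ?_
    simp [Adj, down, h]

/-- A list of vertices that is a closed walk in the ambient graph. -/
def IsClosed (l : List ChainVertex) : Prop :=
  ∀ a, l.head? = some a → (l ++ [a]).IsChain Adj

theorem isClosed_segment (e' w w' s d : ℕ) :
    IsClosed (xSide e' w w' s (d + 1) ++ ySide s (d + 1)) := by
  intro a ha
  obtain rfl : x₀ s = a := by simpa [xSide] using ha
  rw [List.append_assoc]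
  refine isChain_xSide (isChain_ySide (Or.inl (by simp [down])) ?_)
  simp [Adj, down]

theorem isClosed_short {k i : ℕ} (hk : k < 72) (h2 : 2 ≤ k) :
    IsClosed ((List.range k).map (short k i)) := by
  intro a ha
  obtain ⟨k, rfl⟩ : ∃ m, k = m + 2 := ⟨k - 2, by omega⟩
  obtain rfl : short (k + 2) i 0 = a := by simpa [List.range_succ_eq_map] using ha
  rw [List.isChain_append]
  refine ⟨?_, by simp, ?_⟩
  · rw [List.isChain_iff_getElem]
    intro j hj
    simp only [List.length_map, List.length_range] at hj
    refine Or.inl ?_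
    simp only [List.getElem_map, List.getElem_range, down]
    rw [if_neg (by omega)]
    split_ifs <;> simp
  · have e : ((List.range (k + 2)).map (short (k + 2) i)).getLast? =
        some (short (k + 2) i (k + 1)) := by simp [List.range_succ]
    rw [e]
    simp only [Option.mem_def, Option.some.injEq, List.head?_cons]
    rintro _ rfl _ rfl
    refine Or.inr ?_
    simp only [down]
    rw [if_neg (by omega)]
    simp

/-- Any list of cycle lengths is realized by disjoint closed walks that cover a piece exactly. -/
theorem exists_cover (c : List ℕ) : ∃ LL : List (List ChainVertex),
    LL.map List.length = c ∧ (∀ l ∈ LL, 2 ≤ l.length → IsClosed l) ∧ LL.flatten.Nodup ∧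
      ∀ v, v ∈ LL.flatten ↔ InPiece (fun k => c.count k) ((c.filter (72 ≤ ·)).sum / 9)
        ((c.filter (72 ≤ ·)).sum / 9 + (c.filter (72 ≤ ·)).sum % 9) v := by
  induction c with
  | nil =>
    refine ⟨[], rfl, by simp, by simp, fun v => ?_⟩
    simp only [List.flatten_nil, List.not_mem_nil, false_iff]
    cases v <;> simp [InPiece]
  | cons k c ih =>
    obtain ⟨LL, h1, h2, h3, h4⟩ := ih
    by_cases hk : k < 72
    · have hf : ((k :: c).filter (72 ≤ ·)).sum = (c.filter (72 ≤ ·)).sum := by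
        rw [List.filter_cons_of_neg (by simpa using hk)]
      refine ⟨(List.range k).map (short k (c.count k)) :: LL, by simp [h1], ?_, ?_, ?_⟩
      · intro l hl hl2
        rcases List.mem_cons.1 hl with rfl | hl
        · exact isClosed_short hk (by simpa using hl2)
        · exact h2 l hl hl2
      · rw [List.flatten_cons, List.nodup_append']
        refine ⟨List.nodup_range.map fun a b h => by simpa using h, h3, ?_⟩
        intro v hv hv'
        obtain ⟨j, hj, rfl⟩ := List.mem_map.1 hv
        exact absurd ((h4 _).1 hv').2.1 (lt_irrefl _)
      · intro v
        rw [List.flatten_cons, List.mem_append, h4, hf]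
        cases v with
        | short k' i j =>
          simp only [List.mem_map, List.mem_range, InPiece, short.injEq,
            List.count_cons, beq_iff_eq]
          constructor
          · rintro (⟨a, ha, rfl, rfl, rfl⟩ | ⟨g1, g2, g3⟩)
            · simp [hk, ha]
            · exact ⟨g1, by omega, g3⟩
          · rintro ⟨g1, g2, g3⟩
            by_cases hkk : k = k'
            · subst hkk
              rw [if_pos rfl] at g2
              rcases Nat.lt_succ_iff_lt_or_eq.1 g2 with g | g
              · exact Or.inr ⟨g1, g, g3⟩
              · exact Or.inl ⟨j, g3, rfl, g.symm, rfl⟩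
            · rw [if_neg hkk] at g2
              exact Or.inr ⟨g1, g2, g3⟩
        | _ => simp [InPiece]
    · push Not at hk
      -- The long cycles so far use p vertices: p / 9 blocks and p / 9 + p % 9 of the `z t`, since 8
      -- (p / 9) + (p / 9 + p % 9) = p. The new cycle takes exactly the difference between the
      -- pieces for p + k and p.
      set p := (c.filter (72 ≤ ·)).sum with hp
      have hf : ((k :: c).filter (72 ≤ ·)).sum = p + k := by
        rw [List.filter_cons_of_pos (by simpa using hk), List.sum_cons, add_comm]
      obtain ⟨d, hd⟩ : ∃ d, (p + k) / 9 = p / 9 + (d + 1) :=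
        ⟨(p + k) / 9 - p / 9 - 1, by omega⟩
      -- As k ≥ 72, the segment has at least 8 blocks. So a `z t` beyond its end still fits in block
      -- t - 8 of the segment, and those already used, of index below s + 8, do not pass its end.
      have hd7 : 7 ≤ d := by omega
      set s := p / 9 with hs
      set w := p / 9 + p % 9 with hw
      set w' := (p + k) / 9 + (p + k) % 9 with hw'
      have hmem : ∀ v, v ∈ xSide (s + (d + 1)) w w' s (d + 1) ++ ySide s (d + 1) ↔
          InPiece (fun k' => (k :: c).count k') ((p + k) / 9) ((p + k) / 9 + (p + k) % 9) v ∧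
            ¬ InPiece (fun k => c.count k) (p / 9) (p / 9 + p % 9) v := by
        intro v
        rw [List.mem_append, mem_xSide, mem_ySide]
        cases v with
        | short k' i j =>
          simp only [InPiece, reduceCtorEq, and_false, or_false, exists_false, false_iff,
            List.count_cons, beq_iff_eq]
          rintro ⟨⟨g1, g2, g3⟩, g4⟩
          rw [if_neg (by omega)] at g2
          exact g4 ⟨g1, g2, g3⟩
        | z t =>
          simp only [InPiece, reduceCtorEq, and_false, or_false, exists_false, false_or,
            z.injEq]
          constructor
          · rintro ⟨i, g1, g2, ⟨g3, rfl⟩ | ⟨g3, g4, rfl⟩⟩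
            · constructor <;> omega
            · constructor <;> omega
          · rintro ⟨g1, g2⟩
            by_cases ht : t < s + (d + 1)
            · exact ⟨t, by omega, by omega, Or.inl ⟨by omega, rfl⟩⟩
            · exact ⟨t - 8, by omega, by omega, Or.inr ⟨by omega, by omega, by omega⟩⟩
        | _ i =>
          simp only [InPiece, reduceCtorEq, and_false, or_false, exists_false, false_or,
            or_self, x₀.injEq, x₁.injEq, x₂.injEq, x₃.injEq, x₄.injEq, y₀.injEq, y₁.injEq, y₂.injEq]
          constructor
          · rintro ⟨i', g1, g2, rfl⟩
            constructor <;> omega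
          · rintro ⟨g1, g2⟩
            exact ⟨i, by omega, by omega, rfl⟩
      refine ⟨(xSide (s + (d + 1)) w w' s (d + 1) ++ ySide s (d + 1)) :: LL, ?_, ?_, ?_, ?_⟩
      · rw [List.map_cons, h1, List.length_append, length_ySide,
          length_xSide (e := s) rfl le_rfl (by omega) (by omega) (by omega)]
        congr 1
        omega
      · intro l hl hl2
        rcases List.mem_cons.1 hl with rfl | hl
        · exact isClosed_segment _ _ _ _ _
        · exact h2 l hl hl2
      · rw [List.flatten_cons, List.nodup_append', List.nodup_append']
        refine ⟨⟨nodup_xSide le_rfl, nodup_ySide _ _, ?_⟩, h3, ?_⟩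
        · intro v hv hv'
          obtain ⟨i, -, -, g⟩ := mem_xSide.1 hv
          obtain ⟨i', -, -, g'⟩ := mem_ySide.1 hv'
          rcases g' with rfl | rfl | rfl <;> simp at g
        · intro v hv hv'
          exact ((hmem v).1 hv).2 ((h4 v).1 hv')
      · intro v
        rw [List.flatten_cons, List.mem_append, hmem, h4, hf]
        have : InPiece (fun k => c.count k) (p / 9) (p / 9 + p % 9) v →
            InPiece (fun k' => (k :: c).count k') ((p + k) / 9) ((p + k) / 9 + (p + k) % 9) v := by
          cases v with
          | short k' i j =>
            simp only [InPiece, List.count_cons]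
            rintro ⟨g1, g2, g3⟩
            exact ⟨g1, by omega, g3⟩
          | _ => simp only [InPiece]; omega
        tauto

end ChainVertex

/-! ### From embedded pieces to embedded graphs -/

/-- A family of disjoint lists gives a permutation having one cycle for each list of length at
least two. -/
theorem exists_perm_of_nodup_flatten {α : Type*} [Fintype α] [DecidableEq α]
    (L : List (List α)) (hL : L.flatten.Nodup) :
    ∃ τ : Equiv.Perm α, τ.cycleType = (((L.map List.length).filter (2 ≤ ·) : List ℕ) : Multiset ℕ) ∧
      ∀ a, τ a ≠ a → ∃ l ∈ L, 2 ≤ l.length ∧ a ∈ l ∧ τ a = l.formPerm a := by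
  induction L with
  | nil => exact ⟨1, by simp, fun a h => absurd rfl h⟩
  | cons l L ih =>
    rw [List.flatten_cons, List.nodup_append'] at hL
    obtain ⟨hl, hL, hd⟩ := hL
    obtain ⟨τ, h1, h2⟩ := ih hL
    by_cases h : 2 ≤ l.length
    · have hfix : ∀ a ∈ l, τ a = a := by
        intro a ha
        by_contra hne
        obtain ⟨l', hl', -, hal', -⟩ := h2 a hne
        exact hd ha (List.mem_flatten.2 ⟨l', hl', hal'⟩)
      have hdis : (l.formPerm).Disjoint τ := by
        intro a
        by_cases ha : a ∈ l
        · exact Or.inr (hfix a ha)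
        · exact Or.inl (List.formPerm_apply_of_notMem ha)
      refine ⟨l.formPerm * τ, ?_, ?_⟩
      · rw [hdis.cycleType_mul, h1, List.map_cons, List.filter_cons_of_pos (by simpa using h),
          (List.isCycle_formPerm hl h).cycleType,
          List.support_formPerm_of_nodup l hl (fun x hx => by simp [hx] at h),
          List.toFinset_card_of_nodup hl, Multiset.singleton_add, Multiset.cons_coe]
      · intro a ha
        by_cases hal : a ∈ l
        · exact ⟨l, by simp, h, hal, by rw [Equiv.Perm.mul_apply, hfix a hal]⟩
        · have e : (l.formPerm * τ) a = τ a := by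
            rw [hdis.commute.eq, Equiv.Perm.mul_apply, List.formPerm_apply_of_notMem hal]
          rw [e] at ha ⊢
          obtain ⟨l', g1, g2, g3, g4⟩ := h2 a ha
          exact ⟨l', by simp [g1], g2, g3, g4⟩
    · refine ⟨τ, ?_, ?_⟩
      · rw [h1, List.map_cons, List.filter_cons_of_neg (by simpa using h)]
      · intro a ha
        obtain ⟨l', g1, g2, g3, g4⟩ := h2 a ha
        exact ⟨l', by simp [g1], g2, g3, g4⟩

theorem List.rel_formPerm_apply_of_isChain {α : Type*} [DecidableEq α] {R : α → α → Prop}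
    {l : List α} (hl : l.Nodup) (hR : ∀ a, l.head? = some a → (l ++ [a]).IsChain R) {a : α}
    (ha : a ∈ l) : R a (l.formPerm a) := by
  obtain ⟨i, hi, rfl⟩ := List.getElem_of_mem ha
  rw [List.formPerm_apply_getElem l hl i hi]
  have h0 : l.head? = some (l[0]'(by omega)) := by
    rw [List.head?_eq_getElem?, List.getElem?_eq_getElem]
  have h := List.isChain_iff_getElem.1 (hR _ h0) i (by simpa using hi)
  rw [List.getElem_append_left hi] at h
  rcases Nat.lt_or_ge (i + 1) l.length with h1 | h1
  · rw [List.getElem_append_left h1] at h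
    simpa [Nat.mod_eq_of_lt h1] using h
  · have h2 : i + 1 = l.length := by omega
    rw [List.getElem_append_right h1] at h
    simpa [h2] using h

namespace ChainVertex

/-- The finite sets of vertices that are cut out by some parameters. -/
def IsPiece (S : Finset ChainVertex) : Prop :=
  ∃ (m : ℕ → ℕ) (E W : ℕ), W ≤ E + 8 ∧ ∀ v, v ∈ S ↔ InPiece m E W v

/-- The part of the ambient graph on `S` embeds into `G`. -/
def Embeds {V : Type*} (S : Finset ChainVertex) (G : SimpleGraph V) : Prop :=
  ∃ f : ChainVertex → V, Set.InjOn f S ∧ ∀ u ∈ S, ∀ v ∈ S, v ∈ down u → G.Adj (f v) (f u)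

/-- Writing fixed points as parts of size 1, the cycle type becomes a list with sum n. Its cover by
closed walks is a piece with n vertices; the image of these walks in `G` defines a permutation whose
nontrivial arcs are edges of `G`. -/
theorem isContained_of_forall_embeds {n : ℕ} {H G : SimpleGraph (Fin n)}
    (hdeg : ∀ v a b c, H.Adj v a → H.Adj v b → H.Adj v c → a = b ∨ b = c ∨ a = c)
    (hG : ∀ S, IsPiece S → S.card = n → Embeds S G) : H.IsContained G := by
  obtain ⟨σ, hσ, -⟩ := exists_perm_of_degree_le_two H hdeg
  set c : List ℕ := σ.cycleType.toList ++ List.replicate (n - σ.support.card) 1 with hc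
  have hsum : c.sum = n := by
    rw [hc, List.sum_append, Multiset.sum_toList, σ.sum_cycleType]
    have := Finset.card_le_univ σ.support
    simp only [Fintype.card_fin] at this
    simp; omega
  have hfilt : ((c.filter (2 ≤ ·) : List ℕ) : Multiset ℕ) = σ.cycleType := by
    rw [hc, List.filter_append, List.filter_eq_self.2, List.filter_eq_nil_iff.2, List.append_nil,
      Multiset.coe_toList]
    · intro a ha
      simp [List.eq_of_mem_replicate ha]
    · intro a ha
      simpa using Equiv.Perm.two_le_of_mem_cycleType (Multiset.mem_toList.1 ha)
  obtain ⟨L, h1, h2, h3, h4⟩ := exists_cover c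
  have hcard : L.flatten.toFinset.card = n := by
    rw [List.toFinset_card_of_nodup h3, List.length_flatten, h1, hsum]
  have hpiece : IsPiece L.flatten.toFinset := by
    refine ⟨_, _, _, ?_, fun v => List.mem_toFinset.trans (h4 v)⟩
    omega
  obtain ⟨f, hf, hfG⟩ := hG L.flatten.toFinset hpiece hcard
  have hmem : ∀ {l v}, l ∈ L → v ∈ l → v ∈ L.flatten.toFinset := fun hl hv =>
    List.mem_toFinset.2 (List.mem_flatten.2 ⟨_, hl, hv⟩)
  have hnd : (L.map (List.map f)).flatten.Nodup := by
    rw [← List.map_flatten]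
    exact (List.nodup_map_iff_inj_on h3).2 fun x hx y hy h =>
      hf (by simpa using hx) (by simpa using hy) h
  obtain ⟨τ, ht1, ht2⟩ := exists_perm_of_nodup_flatten _ hnd
  have hlen : (L.map (List.map f)).map List.length = c := by
    rw [List.map_map, ← h1]
    simp
  rw [hlen, hfilt] at ht1
  -- Equal cycle types give conjugate permutations, and the conjugating map is the embedding: it
  -- carries arcs of `σ` to arcs of `τ`.
  obtain ⟨g, hg⟩ := isConj_iff.1 (Equiv.Perm.isConj_iff_cycleType_eq.2 ht1.symm)
  have hτ : ∀ a, τ a ≠ a → G.Adj a (τ a) := by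
    intro a ha
    obtain ⟨l', hl', g1, g2, g3⟩ := ht2 a ha
    obtain ⟨l, hl, rfl⟩ := List.mem_map.1 hl'
    rw [g3]
    refine List.rel_formPerm_apply_of_isChain ((List.nodup_flatten.1 hnd).1 _ hl') ?_ g2
    intro b hb
    obtain ⟨b', hb', rfl⟩ : ∃ b', l.head? = some b' ∧ f b' = b := by
      simpa [List.head?_map] using hb
    have hch := h2 l hl (by simpa using g1) b' hb'
    rw [show l.map f ++ [f b'] = (l ++ [b']).map f by simp, List.isChain_map]
    have hin : ∀ x ∈ l ++ [b'], x ∈ L.flatten.toFinset := by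
      intro x hx
      rcases List.mem_append.1 hx with hx | hx
      · exact hmem hl hx
      · rw [List.mem_singleton.1 hx]
        exact hmem hl (List.mem_of_mem_head? hb')
    refine List.IsChain.imp_of_mem_imp ?_ hch
    rintro x y hx hy (hxy | hxy)
    · exact hfG y (hin y hy) x (hin x hx) hxy
    · exact (hfG x (hin x hx) y (hin y hy) hxy).symm
  have hστ : ∀ u, τ (g u) = g (σ u) := fun u => by rw [← hg]; simp
  refine ⟨⟨⟨g, ?_⟩, g.injective⟩⟩
  intro u v huv
  rcases hσ u v huv with h | h
  · have := hτ (g u) (by rw [hστ, h]; exact fun e => huv.ne (g.injective e).symm)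
    rwa [hστ, h] at this
  · have := hτ (g v) (by rw [hστ, h]; exact fun e => huv.ne (g.injective e))
    rw [hστ, h] at this
    exact this.symm

end ChainVertex

/-! ### Independence of edges and unions of random graphs -/

namespace SimpleGraph

open MeasureTheory ProbabilityTheory

variable {V : Type*}

instance [Finite V] : MeasurableSingletonClass (SimpleGraph V) := by
  refine ⟨fun G => ?_⟩
  have h : ({G} : Set (SimpleGraph V)) = ⋂ u, ⋂ v, {G' | G'.Adj u v ↔ G.Adj u v} := by
    ext G'
    simp only [Set.mem_singleton_iff, Set.mem_iInter, Set.mem_ofPred_eq]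
    exact ⟨fun h u v => by rw [h], fun h => by ext u v; exact h u v⟩
  rw [h]
  refine MeasurableSet.iInter fun u => MeasurableSet.iInter fun v => ?_
  have hm : Measurable fun G' : SimpleGraph V => G'.Adj u v :=
    measurable_iff_adj.1 measurable_id u v
  exact hm.setOf.iff (MeasurableSet.const _)

/-- The law of the indicator of the edges of a binomial random graph. -/
noncomputable def edgeLaw (V : Type*) (p : unitInterval) : Measure (Sym2 V → Prop) :=
  Measure.infinitePi fun e : Sym2 V =>
    unitInterval.toNNReal p • Measure.dirac (e ∈ (Sym2.diagSetᶜ : Set (Sym2 V))) +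
      unitInterval.toNNReal (unitInterval.symm p) • Measure.dirac False

instance (p : unitInterval) : IsProbabilityMeasure (edgeLaw V p) := by
  unfold edgeLaw; infer_instance

theorem binomialRandom_real_eq_edgeLaw [Finite V] (p : unitInterval) (S : Set (SimpleGraph V)) :
    (binomialRandom V p).real S = (edgeLaw V p).real {ω | fromEdgeSet {e | ω e} ∈ S} := by
  have hm : Measurable fun ω : Sym2 V → Prop => {e | ω e} := MeasurableEquiv.setOfPred.measurable
  rw [binomialRandom_eq_map, setBernoulli_eq_map, Measure.map_map measurable_fromEdgeSet hm,
    map_measureReal_apply (measurable_fromEdgeSet.comp hm) S.toFinite.measurableSet]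
  rfl

theorem edgeLaw_real_pi (p : unitInterval) (D : Finset (Sym2 V)) (t : Set Prop) (x : ℝ)
    (h : ∀ e ∈ D, (unitInterval.toNNReal p • Measure.dirac
        (e ∈ (Sym2.diagSetᶜ : Set (Sym2 V))) +
      unitInterval.toNNReal (unitInterval.symm p) • Measure.dirac False).real t = x) :
    (edgeLaw V p).real {ω | ∀ e ∈ D, ω e ∈ t} = x ^ D.card := by
  have e1 : {ω : Sym2 V → Prop | ∀ e ∈ D, ω e ∈ t} = (D : Set (Sym2 V)).pi fun _ => t := by
    ext; simp [Set.mem_pi]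
  rw [e1, Measure.real, edgeLaw, Measure.infinitePi_pi _ (fun _ _ => t.toFinite.measurableSet),
    ENNReal.toReal_prod]
  exact Finset.prod_eq_pow_card h

theorem edgeLaw_real_forall (p : unitInterval) (D : Finset (Sym2 V)) (hD : ∀ e ∈ D, ¬ e.IsDiag) :
    (edgeLaw V p).real {ω | ∀ e ∈ D, ω e} = (p : ℝ) ^ D.card := by
  have := edgeLaw_real_pi p D {True} p fun e he => by
    simp [measureReal_def, hD e he]
  simpa using this

theorem edgeLaw_real_forall_not (p : unitInterval) (D : Finset (Sym2 V)) (hD : ∀ e ∈ D, ¬ e.IsDiag) :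
    (edgeLaw V p).real {ω | ∀ e ∈ D, ¬ ω e} = (1 - p : ℝ) ^ D.card := by
  have := edgeLaw_real_pi p D {False} (1 - p) fun e he => by
    simp [measureReal_def, hD e he]
  simpa using this

/-- Events that depend on disjoint sets of edges are independent; one index is split off at a time.
-/
theorem edgeLaw_real_forall_exists_not [Finite V] (p : unitInterval) {ι : Type*} (I : Finset ι)
    (D : ι → Finset (Sym2 V)) (hD : ∀ i ∈ I, ∀ e ∈ D i, ¬ e.IsDiag)
    (hdis : (I : Set ι).PairwiseDisjoint D) :
    (edgeLaw V p).real {ω | ∀ i ∈ I, ∃ e ∈ D i, ¬ ω e} = ∏ i ∈ I, (1 - (p : ℝ) ^ (D i).card) := by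
  classical
  induction I using Finset.induction_on with
  | empty => simp
  | insert a I ha ih =>
    have hind : iIndepFun (fun (e : Sym2 V) (ω : Sym2 V → Prop) => ω e) (edgeLaw V p) :=
      iIndepFun_infinitePi (X := fun _ x => x) (fun _ => measurable_id)
    have hdisj : Disjoint (D a) (I.biUnion D) := by
      rw [Finset.disjoint_biUnion_right]
      intro i hi
      exact hdis (by simp) (by simp [hi]) (by rintro rfl; exact ha hi)
    have h2 := (hind.indepFun_finset _ _ hdisj (fun e => measurable_pi_apply e)).measure_inter_preimage_eq_mul
      {x | ∃ e, ¬ x e} {x | ∀ i ∈ I, ∃ e, ∃ h : e ∈ I.biUnion D, e ∈ D i ∧ ¬ x ⟨e, h⟩}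
      (Set.toFinite _).measurableSet (Set.toFinite _).measurableSet
    have e0 : {ω : Sym2 V → Prop | ∀ i ∈ insert a I, ∃ e ∈ D i, ¬ ω e} =
        ((fun ω (e : D a) => ω e) ⁻¹' {x | ∃ e, ¬ x e}) ∩
        ((fun ω (e : I.biUnion D) => ω e) ⁻¹'
          {x | ∀ i ∈ I, ∃ e, ∃ h : e ∈ I.biUnion D, e ∈ D i ∧ ¬ x ⟨e, h⟩}) := by
      ext ω
      simp only [Finset.forall_mem_insert, Set.mem_ofPred_eq, Set.mem_inter_iff, Set.mem_preimage,
        Subtype.exists, exists_prop]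
      refine and_congr Iff.rfl (forall₂_congr fun i hi => exists_congr fun e => ?_)
      simp only [Finset.mem_biUnion]
      tauto
    have e1 : (fun (ω : Sym2 V → Prop) (e : D a) => ω e) ⁻¹' {x | ∃ e, ¬ x e} =
        {ω | ∀ e ∈ D a, ω e}ᶜ := by
      ext ω; simp
    have e2 : (fun (ω : Sym2 V → Prop) (e : I.biUnion D) => ω e) ⁻¹'
          {x | ∀ i ∈ I, ∃ e, ∃ h : e ∈ I.biUnion D, e ∈ D i ∧ ¬ x ⟨e, h⟩} =
        {ω | ∀ i ∈ I, ∃ e ∈ D i, ¬ ω e} := by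
      ext ω
      simp only [Set.mem_ofPred_eq, Set.mem_preimage]
      refine forall₂_congr fun i hi => exists_congr fun e => ?_
      simp only [Finset.mem_biUnion]
      exact ⟨fun ⟨_, h⟩ => h, fun h => ⟨⟨i, hi, h.1⟩, h⟩⟩
    rw [← e0, e1, e2] at h2
    rw [Finset.prod_insert ha, measureReal_def, h2, ENNReal.toReal_mul, ← measureReal_def,
      ← measureReal_def, ih (fun i hi => hD i (by simp [hi]))
        (hdis.subset (by simp)), probReal_compl_eq_one_sub (Set.toFinite _).measurableSet,
      edgeLaw_real_forall p (D a) (hD a (by simp))]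

/-- What matters is that the exponent depends on `D` alone: the probabilities for different edge
densities then multiply to a power with the same exponent. -/
theorem exists_binomialRandom_real_forall_notMem [Finite V] (D : Finset (Sym2 V)) :
    ∃ k : ℕ, ∀ p : unitInterval,
      (binomialRandom V p).real {G | ∀ e ∈ D, e ∉ G.edgeSet} = (1 - p : ℝ) ^ k := by
  classical
  refine ⟨(D.filter fun e => ¬ e.IsDiag).card, fun p => ?_⟩
  rw [binomialRandom_real_eq_edgeLaw, ← edgeLaw_real_forall_not p _ (by simp)]
  congr 1
  ext ω
  simp only [Set.mem_ofPred_eq, edgeSet_fromEdgeSet, Finset.mem_filter, Set.mem_sdiff,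
    Sym2.mem_diagSet]
  exact ⟨fun h e he hω => h e he.1 ⟨hω, he.2⟩, fun h e he hω => h e ⟨he, hω.2⟩ hω.1⟩

/-- The union of independent binomial random graphs is a binomial random graph. -/
theorem map_sup_binomialRandom [Finite V] (p q : unitInterval) :
    ((binomialRandom V p).prod (binomialRandom V q)).map (fun x => x.1 ⊔ x.2) =
      binomialRandom V (unitInterval.symm (unitInterval.symm p * unitInterval.symm q)) := by
  have hm : Measurable fun x : SimpleGraph V × SimpleGraph V => x.1 ⊔ x.2 := measurable_of_finite _
  have := Measure.isProbabilityMeasure_map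
    (μ := (binomialRandom V p).prod (binomialRandom V q)) hm.aemeasurable
  -- The events that no edge lies in D form a generating π-system, and a union of two graphs avoids
  -- D exactly when both graphs do.
  refine ext_of_generate_finite
    {A : Set (SimpleGraph V) | ∃ D : Finset (Sym2 V), A = {G | ∀ e ∈ D, e ∉ G.edgeSet}} ?_ ?_ ?_ ?_
  · refine le_antisymm ?_ ?_
    · have := (measurable_iff_adj (m := MeasurableSpace.generateFrom
        {A : Set (SimpleGraph V) | ∃ D : Finset (Sym2 V), A = {G | ∀ e ∈ D, e ∉ G.edgeSet}})
        (G := id)).2 ?_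
      · simpa using this.comap_le
      · intro u v
        refine measurable_to_prop ?_
        refine MeasurableSet.of_compl (MeasurableSpace.measurableSet_generateFrom ⟨{s(u, v)}, ?_⟩)
        ext G; simp
    · refine MeasurableSpace.generateFrom_le ?_
      rintro A -
      exact A.toFinite.measurableSet
  · classical
    rintro _ ⟨D, rfl⟩ _ ⟨D', rfl⟩ -
    refine ⟨D ∪ D', ?_⟩
    ext G
    simp only [Set.mem_inter_iff, Set.mem_ofPred_eq, Finset.mem_union, or_imp, forall_and]
  · rintro _ ⟨D, rfl⟩
    rw [Measure.map_apply hm (Set.toFinite _).measurableSet]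
    have e : (fun x : SimpleGraph V × SimpleGraph V => x.1 ⊔ x.2) ⁻¹'
        {G | ∀ e ∈ D, e ∉ G.edgeSet} =
        {G | ∀ e ∈ D, e ∉ G.edgeSet} ×ˢ {G | ∀ e ∈ D, e ∉ G.edgeSet} := by
      ext x
      simp only [Set.mem_preimage, edgeSet_sup, Set.mem_union, not_or, Set.mem_ofPred_eq,
        Set.mem_prod]
      exact ⟨fun h => ⟨fun e he => (h e he).1, fun e he => (h e he).2⟩,
        fun h e he => ⟨h.1 e he, h.2 e he⟩⟩
    rw [e, Measure.prod_prod, ← ENNReal.toReal_eq_toReal_iff' (by finiteness) (by finiteness),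
      ENNReal.toReal_mul, ← measureReal_def, ← measureReal_def, ← measureReal_def]
    obtain ⟨k, hk⟩ := exists_binomialRandom_real_forall_notMem D
    simp only [hk]
    rw [← mul_pow]
    simp
  · simp

end SimpleGraph

/-! ### Hall's theorem in a random graph -/

/-- Counts the possible Hall violators: k indices and N + 1 - k vertices that none of them can use.
The exponent is the minimum of the two sizes because binomial coefficients are symmetric. -/
theorem Nat.choose_mul_choose_le_pow {m N k : ℕ} (hm : m ≤ N) (h1 : 1 ≤ k) (hk : k ≤ N) :
    m.choose k * N.choose (N + 1 - k) ≤ (N ^ 2) ^ min k (N + 1 - k) := by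
  have a1 : m.choose k ≤ N.choose k := Nat.choose_le_choose k hm
  have a2 : N.choose (N + 1 - k) = N.choose (k - 1) := by
    rw [← Nat.choose_symm (show k - 1 ≤ N by omega)]; congr 1; omega
  have a3 : N.choose k = N.choose (N - k) := (Nat.choose_symm hk).symm
  have hN : 1 ≤ N := by omega
  rcases le_total k (N + 1 - k) with h | h
  · rw [min_eq_left h, pow_two, mul_pow]
    refine Nat.mul_le_mul (a1.trans (Nat.choose_le_pow _ _)) ?_
    rw [a2]
    exact (Nat.choose_le_pow _ _).trans (Nat.pow_le_pow_right hN (by omega))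
  · rw [min_eq_right h, pow_two, mul_pow]
    refine Nat.mul_le_mul ?_ (Nat.choose_le_pow _ _)
    refine a1.trans (a3.le.trans ((Nat.choose_le_pow _ _).trans ?_))
    exact Nat.pow_le_pow_right hN (by omega)

namespace SimpleGraph

open MeasureTheory ProbabilityTheory

/-- A binomial random graph contains a system of distinct vertices `g i` in `R`, each adjacent to
all of the set `B i`, except with small probability. -/
theorem binomialRandom_real_not_exists_injective_le {V ι : Type*} [Finite V] [Fintype ι]
    (p : unitInterval) (B : ι → Finset V) (R : Finset V) (hcard : ∀ i, (B i).card ≤ 2)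
    (hdis : ∀ i j v, v ∈ B i → v ∈ B j → i = j) (hR : ∀ i, ∀ v ∈ B i, v ∉ R)
    (hle : Fintype.card ι ≤ R.card) :
    (binomialRandom V p).real {G | ¬ ∃ g : ι → V, Function.Injective g ∧
      ∀ i, g i ∈ R ∧ ∀ b ∈ B i, G.Adj b (g i)} ≤
      (R.card : ℝ) ^ 3 * Real.exp (-((p : ℝ) ^ 2 * R.card / 2)) := by
  classical
  set N := R.card with hN
  set a : ℝ := 1 - (p : ℝ) ^ 2 with ha
  have hp0 : (0 : ℝ) ≤ p := p.2.1
  have hp1 : (p : ℝ) ≤ 1 := p.2.2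
  have ha0 : 0 ≤ a := by rw [ha]; nlinarith
  set bad : Finset ι → Finset V → Set (SimpleGraph V) :=
    fun s T => {G | ∀ i ∈ s, ∀ w ∈ T, ∃ b ∈ B i, ¬ G.Adj b w} with hbad
  -- Distinct pairs (i, w) test disjoint sets of edges, because the `B i` are disjoint and avoid
  -- `R`. So the failures of the pairs are independent.
  have hprob : ∀ (s : Finset ι) (T : Finset V), T ⊆ R →
      (binomialRandom V p).real (bad s T) ≤ a ^ (s.card * T.card) := by
    intro s T hT
    have key := edgeLaw_real_forall_exists_not (V := V) p (s ×ˢ T)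
      (fun x => (B x.1).image fun b => s(b, x.2)) ?_ ?_
    · rw [binomialRandom_real_eq_edgeLaw]
      calc _ = _ := ?_
        _ = _ := key
        _ ≤ ∏ i ∈ s ×ˢ T, a := ?_
        _ = _ := by rw [Finset.prod_const, Finset.card_product]
      · congr 1
        ext ω
        simp only [hbad, Set.mem_ofPred_eq, Finset.mem_product, Finset.mem_image, fromEdgeSet_adj,
          not_and, and_imp, Prod.forall]
        constructor
        · intro h i w hi hw
          obtain ⟨b, hb, hbw⟩ := h i hi w hw
          exact ⟨_, ⟨b, hb, rfl⟩, fun hω => hbw hω fun e => hR i b hb (hT (e ▸ hw))⟩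
        · intro h i hi w hw
          obtain ⟨_, ⟨b, hb, rfl⟩, hω⟩ := h i w hi hw
          exact ⟨b, hb, fun h => absurd h hω⟩
      · refine Finset.prod_le_prod (fun x _ => ?_) (fun x _ => ?_)
        · exact sub_nonneg.2 (pow_le_one₀ hp0 hp1)
        · refine sub_le_sub_left (pow_le_pow_of_le_one hp0 hp1 ?_) 1
          exact Finset.card_image_le.trans (hcard _)
    · intro x hx e he
      obtain ⟨b, hb, rfl⟩ := Finset.mem_image.1 he
      rw [Sym2.mk_isDiag_iff]
      rintro rfl
      exact hR _ _ hb (hT (Finset.mem_product.1 hx).2)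
    · intro x hx y hy hxy
      rw [Function.onFun, Finset.disjoint_left]
      intro e he he'
      obtain ⟨b, hb, rfl⟩ := Finset.mem_image.1 he
      obtain ⟨b', hb', h⟩ := Finset.mem_image.1 he'
      have hx2 := (Finset.mem_product.1 hx).2
      have hy2 := (Finset.mem_product.1 hy).2
      rcases Sym2.eq_iff.1 h with ⟨rfl, h2⟩ | ⟨h1, h2⟩
      · exact hxy (Prod.ext (hdis _ _ _ hb hb') h2.symm)
      · exact hR _ _ hb (hT (h2 ▸ hy2))
  -- By Hall, failure gives a set s with fewer than |s| usable vertices in `R`, so at least N + 1 -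
  -- |s| vertices are unusable for all of s.
  have hsub : {G : SimpleGraph V | ¬ ∃ g : ι → V, Function.Injective g ∧
      ∀ i, g i ∈ R ∧ ∀ b ∈ B i, G.Adj b (g i)} ⊆
      ⋃ k ∈ Finset.Icc 1 N, ⋃ x ∈ (Finset.univ : Finset ι).powersetCard k ×ˢ
        R.powersetCard (N + 1 - k), bad x.1 x.2 := by
    intro G hG
    set t : ι → Finset V := fun i => R.filter fun w => ∀ b ∈ B i, G.Adj b w with ht
    have hall := (Finset.all_card_le_biUnion_card_iff_exists_injective t).not.2 (by
      rintro ⟨g, hg, hgt⟩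
      exact hG ⟨g, hg, fun i => by simpa [ht] using hgt i⟩)
    push Not at hall
    obtain ⟨s, hs⟩ := hall
    have hsN : s.card ≤ N := (Finset.card_le_univ s).trans hle
    have hsubR : s.biUnion t ⊆ R := Finset.biUnion_subset.2 fun i _ => Finset.filter_subset _ _
    have hc := Finset.card_sdiff_add_card_eq_card hsubR
    obtain ⟨T, hT, hTc⟩ := Finset.exists_subset_card_eq
      (show N + 1 - s.card ≤ (R \ s.biUnion t).card by omega)
    simp only [Set.mem_iUnion, Finset.mem_Icc, Finset.mem_product, Finset.mem_powersetCard]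
    refine ⟨s.card, ⟨by omega, hsN⟩, (s, T), ⟨⟨Finset.subset_univ _, rfl⟩,
      hT.trans Finset.sdiff_subset, hTc⟩, ?_⟩
    intro i hi w hw
    by_contra hcon
    push Not at hcon
    have hw' := Finset.mem_sdiff.1 (hT hw)
    exact hw'.2 (Finset.mem_biUnion.2 ⟨i, hi, Finset.mem_filter.2 ⟨hw'.1, hcon⟩⟩)
  set y : ℝ := (N : ℝ) ^ 2 * Real.exp (-((p : ℝ) ^ 2 * N / 2)) with hy
  have hy0 : 0 ≤ y := by positivity
  have hterm : y ≤ 1 → ∀ k ∈ Finset.Icc 1 N, (binomialRandom V p).real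
      (⋃ x ∈ (Finset.univ : Finset ι).powersetCard k ×ˢ R.powersetCard (N + 1 - k), bad x.1 x.2)
        ≤ y := by
    intro hy1 k hk
    obtain ⟨hk1, hkN⟩ := Finset.mem_Icc.1 hk
    obtain ⟨j, hj⟩ : ∃ j, j = N + 1 - k := ⟨_, rfl⟩
    calc _ ≤ ∑ x ∈ (Finset.univ : Finset ι).powersetCard k ×ˢ R.powersetCard (N + 1 - k),
          (binomialRandom V p).real (bad x.1 x.2) := measureReal_biUnion_finset_le _ _
      _ ≤ ∑ x ∈ (Finset.univ : Finset ι).powersetCard k ×ˢ R.powersetCard (N + 1 - k),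
          a ^ (k * j) := by
        refine Finset.sum_le_sum fun x hx => ?_
        simp only [Finset.mem_product, Finset.mem_powersetCard] at hx
        obtain ⟨⟨-, hx1⟩, hx2, hx3⟩ := hx
        have := hprob x.1 x.2 hx2
        rwa [hx1, hx3, ← hj] at this
      _ = ((Fintype.card ι).choose k * N.choose j : ℕ) * a ^ (k * j) := by
        rw [Finset.sum_const, nsmul_eq_mul, Finset.card_product, Finset.card_powersetCard,
          Finset.card_powersetCard, Finset.card_univ, ← hj]
      _ ≤ ((N : ℝ) ^ 2) ^ min k j * Real.exp (-((p : ℝ) ^ 2 * N / 2)) ^ min k j := by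
        gcongr
        · have := Nat.choose_mul_choose_le_pow hle hk1 hkN
          rw [← hj] at this
          exact_mod_cast this
        · have h1 : a ≤ Real.exp (-(p : ℝ) ^ 2) := by
            have := Real.add_one_le_exp (-(p : ℝ) ^ 2); rw [ha]; linarith
          calc a ^ (k * j) ≤ Real.exp (-(p : ℝ) ^ 2) ^ (k * j) := by gcongr
            _ = Real.exp (-(p : ℝ) ^ 2 * (k * j : ℕ)) := by
              rw [← Real.exp_nat_mul]; ring_nf
            _ ≤ Real.exp ((min k j : ℕ) * (-((p : ℝ) ^ 2 * N / 2))) := by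
              apply Real.exp_le_exp.2
              -- Since k + j = N + 1, the larger of the two is at least N / 2.
              have h2 : min k j * N ≤ 2 * (k * j) := by
                rcases le_total k j with h | h
                · rw [min_eq_left h]
                  have : N ≤ 2 * j := by omega
                  nlinarith
                · rw [min_eq_right h]
                  have : N ≤ 2 * k := by omega
                  nlinarith
              have h3 : ((min k j : ℕ) : ℝ) * N ≤ 2 * ((k * j : ℕ) : ℝ) := by exact_mod_cast h2
              nlinarith [sq_nonneg (p : ℝ)]
            _ = _ := Real.exp_nat_mul _ _
      _ = y ^ min k j := by rw [← mul_pow]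
      _ ≤ y := pow_le_of_le_one hy0 hy1 (by omega)
  have hfin : (N : ℝ) ^ 3 * Real.exp (-((p : ℝ) ^ 2 * N / 2)) = N * y := by rw [hy]; ring
  rw [hfin]
  rcases Nat.eq_zero_or_pos N with h0 | hpos
  · have : IsEmpty ι := Fintype.card_eq_zero_iff.1 (by omega)
    have : {G : SimpleGraph V | ¬ ∃ g : ι → V, Function.Injective g ∧
      ∀ i, g i ∈ R ∧ ∀ b ∈ B i, G.Adj b (g i)} = ∅ := by
      rw [Set.eq_empty_iff_forall_notMem]
      exact fun G hG => hG ⟨isEmptyElim, fun i => isEmptyElim i, fun i => isEmptyElim i⟩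
    rw [this]
    simp [h0]
  -- For y > 1 the claimed bound N * y exceeds 1 and is trivial.
  rcases le_or_gt y 1 with hy1 | hy1
  · calc _ ≤ _ := measureReal_mono hsub (measure_ne_top _ _)
      _ ≤ _ := measureReal_biUnion_finset_le _ _
      _ ≤ ∑ k ∈ Finset.Icc 1 N, y := Finset.sum_le_sum (hterm hy1)
      _ = N * y := by simp
  · have : (1 : ℝ) ≤ N := by exact_mod_cast hpos
    exact measureReal_le_one.trans (by nlinarith)

end SimpleGraph

/-! ### Embedding layer by layer -/

namespace SimpleGraph

open MeasureTheory ProbabilityTheory unitInterval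

/-- The vertices of `S` in the layers below `j` are embedded by `f`, together with the arcs `down`
among them. -/
def EmbedsBelow {U V : Type*} (S : Finset U) (down : U → Finset U) (layer : U → ℕ) (j : ℕ)
    (G : SimpleGraph V) (f : U → V) : Prop :=
  Set.InjOn f {u | u ∈ S ∧ layer u < j} ∧
    ∀ u ∈ S, layer u < j → ∀ v ∈ S, v ∈ down u → G.Adj (f v) (f u)

variable {U V : Type*} [Fintype V] [DecidableEq U] {S : Finset U} {down : U → Finset U}
  {layer : U → ℕ}

/-- Layer j is matched into the vertices unused by `f`. As `S` has as many vertices as `V`, their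
number is that of the vertices of `S` in layers j and above, which is at least `L`. -/
theorem EmbedsBelow.binomialRandom_real_step_le (p : unitInterval) {j L : ℕ} {G : SimpleGraph V}
    {f : U → V} (hf : EmbedsBelow S down layer j G f)
    (hlt : ∀ u, ∀ v ∈ down u, layer v < layer u)
    (hcard : ∀ u, (down u).card ≤ 2)
    (hdis : ∀ u v w, layer u = layer v → w ∈ down u → w ∈ down v → u = v)
    (hSV : S.card = Fintype.card V)
    (hL : L ≤ (S.filter fun u => j ≤ layer u).card) :
    (binomialRandom V p).real {G' | ¬ ∃ g, EmbedsBelow S down layer (j + 1) (G ⊔ G') g} ≤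
      (Fintype.card V : ℝ) ^ 3 * Real.exp (-((p : ℝ) ^ 2 * L / 2)) := by
  classical
  set X : Finset V := (S.filter fun u => layer u < j).image f with hX
  have hXc : X.card = (S.filter fun u => layer u < j).card := by
    refine Finset.card_image_of_injOn fun u hu v hv h => hf.1 ?_ ?_ h
    · simpa using hu
    · simpa using hv
  have hsplit : (S.filter fun u => layer u < j).card + (S.filter fun u => j ≤ layer u).card =
      S.card := by
    rw [← Finset.card_filter_add_card_filter_not (s := S) (fun u => layer u < j)]
    simp only [not_lt]
  have hRc : Xᶜ.card = (S.filter fun u => j ≤ layer u).card := by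
    rw [Finset.card_compl, hXc]; omega
  have hlayer : (S.filter fun u => layer u = j).card ≤ (S.filter fun u => j ≤ layer u).card :=
    Finset.card_le_card (Finset.monotone_filter_right S fun u hu => by simp_all)
  have hdown : ∀ u v, layer u = j → v ∈ down u → layer v < j := fun u v hu hv => hu ▸ hlt u v hv
  have key := binomialRandom_real_not_exists_injective_le p
    (ι := {u // u ∈ S.filter fun u => layer u = j}) (fun u => (down u ∩ S).image f) Xᶜ ?_ ?_ ?_ ?_
  · refine (measureReal_mono ?_ (measure_ne_top _ _)).trans (key.trans ?_)
    · intro G' hG' ⟨g, hg, hgR⟩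
      refine hG' ⟨fun u => if h : u ∈ S.filter fun u => layer u = j then g ⟨u, h⟩ else f u, ?_, ?_⟩
      · have hne : ∀ u (hu : u ∈ S.filter fun u => layer u = j), ∀ v ∈ S, layer v < j →
            g ⟨u, hu⟩ ≠ f v := by
          intro u hu v hv hvj h
          refine Finset.mem_compl.1 (hgR ⟨u, hu⟩).1 ?_
          rw [h]
          exact Finset.mem_image_of_mem f (Finset.mem_filter.2 ⟨hv, hvj⟩)
        rintro u ⟨huS, huj⟩ v ⟨hvS, hvj⟩ h
        simp only at h
        split_ifs at h with h1 h2 h2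
        · exact congrArg Subtype.val (hg h)
        · simp only [Finset.mem_filter, not_and] at h2
          have := h2 hvS
          exact absurd h (hne u h1 v hvS (by omega))
        · simp only [Finset.mem_filter, not_and] at h1
          have := h1 huS
          exact absurd h.symm (hne v h2 u huS (by omega))
        · simp only [Finset.mem_filter, not_and] at h1 h2
          have := h1 huS
          have := h2 hvS
          exact hf.1 ⟨huS, by omega⟩ ⟨hvS, by omega⟩ h
      · intro u huS huj v hvS hv
        have hvlt := hlt u v hv
        have hv' : ¬ v ∈ S.filter fun u => layer u = j := by
          simp only [Finset.mem_filter, not_and]; omega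
        beta_reduce
        rw [dif_neg hv']
        split_ifs with h1
        · exact Or.inr ((hgR ⟨u, h1⟩).2 _ (Finset.mem_image_of_mem f
            (Finset.mem_inter.2 ⟨hv, hvS⟩)))
        · simp only [Finset.mem_filter, not_and] at h1
          have := h1 huS
          exact Or.inl (hf.2 u huS (by omega) v hvS hv)
    · have h1 : (L : ℝ) ≤ Xᶜ.card := by rw [hRc]; exact_mod_cast hL
      have h2 : (Xᶜ.card : ℝ) ≤ Fintype.card V := by exact_mod_cast Finset.card_le_univ _
      gcongr
  · exact fun u => Finset.card_image_le.trans
      ((Finset.card_le_card Finset.inter_subset_left).trans (hcard _))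
  · rintro ⟨u, hu⟩ ⟨v, hv⟩ x hx hx'
    obtain ⟨w, hw, rfl⟩ := Finset.mem_image.1 hx
    obtain ⟨w', hw', h⟩ := Finset.mem_image.1 hx'
    simp only [Finset.mem_filter, Finset.mem_inter] at hu hv hw hw'
    obtain rfl : w' = w := hf.1 ⟨hw'.2, hdown v w' hv.2 hw'.1⟩ ⟨hw.2, hdown u w hu.2 hw.1⟩ h
    exact Subtype.ext (hdis u v w' (hu.2.trans hv.2.symm) hw.1 hw'.1)
  · rintro ⟨u, hu⟩ x hx
    obtain ⟨w, hw, rfl⟩ := Finset.mem_image.1 hx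
    simp only [Finset.mem_filter, Finset.mem_inter] at hu hw
    rw [Finset.mem_compl, not_not]
    exact Finset.mem_image_of_mem f (Finset.mem_filter.2 ⟨hw.2, hdown u w hu.2 hw.1⟩)
  · rw [Fintype.card_coe, hRc]
    exact hlayer

/-- Embedding a layered graph layer by layer into a union of independent random graphs. -/
theorem binomialRandom_not_exists_embedsBelow_le [Nonempty V] (p : unitInterval) {L t : ℕ}
    (hlt : ∀ u, ∀ v ∈ down u, layer v < layer u)
    (hcard : ∀ u, (down u).card ≤ 2)
    (hdis : ∀ u v w, layer u = layer v → w ∈ down u → w ∈ down v → u = v)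
    (hSV : S.card = Fintype.card V)
    (hL : L ≤ (S.filter fun u => t ≤ layer u).card) {j : ℕ} (hj : j ≤ t + 1) :
    binomialRandom V (σ (σ p ^ j)) {G | ¬ ∃ f, EmbedsBelow S down layer j G f} ≤
      j * ENNReal.ofReal ((Fintype.card V : ℝ) ^ 3 * Real.exp (-((p : ℝ) ^ 2 * L / 2))) := by
  classical
  set δ := ENNReal.ofReal ((Fintype.card V : ℝ) ^ 3 * Real.exp (-((p : ℝ) ^ 2 * L / 2))) with hδ
  induction j with
  | zero =>
    have : {G : SimpleGraph V | ¬ ∃ f, EmbedsBelow S down layer 0 G f} = ∅ := by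
      rw [Set.eq_empty_iff_forall_notMem]
      intro G hG
      exact hG ⟨fun _ => Classical.arbitrary V, by intro u hu; simp at hu,
        fun u _ hu => absurd hu (by simp)⟩
    rw [this]
    simp
  | succ j ih =>
    have hm : Measurable fun x : SimpleGraph V × SimpleGraph V => x.1 ⊔ x.2 :=
      measurable_of_finite _
    -- The union of j + 1 copies is split into the union of j copies and one fresh copy.
    have e : σ (σ p ^ (j + 1)) = σ (σ (σ (σ p ^ j)) * σ p) := by
      rw [symm_symm, pow_succ]
    rw [e, ← map_sup_binomialRandom, Measure.map_apply hm (Set.toFinite _).measurableSet]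
    have hsub : (fun x : SimpleGraph V × SimpleGraph V => x.1 ⊔ x.2) ⁻¹'
        {G | ¬ ∃ f, EmbedsBelow S down layer (j + 1) G f} ⊆
        ({G | ¬ ∃ f, EmbedsBelow S down layer j G f} ×ˢ Set.univ) ∪
        {x | (∃ f, EmbedsBelow S down layer j x.1 f) ∧
          ¬ ∃ f, EmbedsBelow S down layer (j + 1) (x.1 ⊔ x.2) f} := by
      intro x hx
      by_cases h : ∃ f, EmbedsBelow S down layer j x.1 f
      · exact Or.inr ⟨h, hx⟩
      · exact Or.inl ⟨h, trivial⟩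
    refine (measure_mono hsub).trans ((measure_union_le _ _).trans ?_)
    rw [Nat.cast_succ, add_mul, one_mul]
    refine add_le_add ?_ ?_
    · rw [Measure.prod_prod, measure_univ, mul_one]
      exact ih (by omega)
    -- With the first graph and its embedding fixed, only the fresh copy is random, so the one-layer
    -- bound applies for each first graph.
    · rw [Measure.prod_apply (Set.toFinite _).measurableSet]
      refine (lintegral_mono (g := fun _ => δ) fun G => ?_).trans (by simp)
      by_cases h : ∃ f, EmbedsBelow S down layer j G f
      · obtain ⟨f, hf⟩ := h
        have hLj : L ≤ (S.filter fun u => j ≤ layer u).card :=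
          hL.trans (Finset.card_le_card (Finset.monotone_filter_right S fun u _ (hu : t ≤ layer u) =>
            show j ≤ layer u by omega))
        have := hf.binomialRandom_real_step_le p hlt hcard hdis hSV hLj
        rw [hδ, ENNReal.le_ofReal_iff_toReal_le (measure_ne_top _ _) (by positivity)]
        refine (measureReal_mono (fun G' hG' => hG'.2) (measure_ne_top _ _)).trans this
      · simp [h]

end SimpleGraph

/-! ### Size of the top layer and number of pieces -/

namespace ChainVertex

theorem layer_lt_of_inPiece {m : ℕ → ℕ} {E W : ℕ} {v : ChainVertex} (h : InPiece m E W v) :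
    layer v < 72 := by
  cases v with
  | short k i j =>
    obtain ⟨h1, -, h3⟩ := h
    simp only [layer]
    split_ifs <;> omega
  | _ => simp [layer]

/-- The top-layer vertex of the cycle or block of a vertex. -/
def anchor : ChainVertex → ChainVertex
  | short k i _ => short k i (k - 1)
  | x₀ i => y₁ i
  | x₁ i => y₁ i
  | x₂ i => y₁ i
  | x₃ i => y₁ i
  | x₄ i => y₁ i
  | y₀ i => y₁ i
  | y₁ i => y₁ i
  | y₂ i => y₁ i
  | z i => y₁ i

/-- The position of a vertex in its cycle or block. -/
def position : ChainVertex → ℕ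
  | short _ _ j => j
  | x₀ _ => 0
  | x₁ _ => 1
  | x₂ _ => 2
  | x₃ _ => 3
  | x₄ _ => 4
  | y₀ _ => 5
  | y₁ _ => 6
  | y₂ _ => 7
  | z _ => 8

theorem eq_of_anchor_eq {u v : ChainVertex} (h : anchor u = anchor v)
    (h' : position u = position v) : u = v := by
  cases u <;> cases v <;> simp_all [anchor, position]

/-- A vertex is determined by its anchor and its position, of which there are at most 72. Only the
at most 8 vertices `z t` with E ≤ t < E + 8 have an anchor outside the piece. -/
theorem IsPiece.card_le {S : Finset ChainVertex} (hS : IsPiece S) :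
    S.card ≤ 72 * (S.filter fun v => 71 ≤ layer v).card + 8 := by
  obtain ⟨m, E, W, hW, hS⟩ := hS
  have h1 : (S.filter fun v => anchor v ∈ S).card ≤
      ((S.filter fun v => 71 ≤ layer v) ×ˢ Finset.range 72).card := by
    refine Finset.card_le_card_of_injOn (fun v => (anchor v, position v)) ?_ ?_
    · intro v hv
      simp only [Finset.coe_filter, Set.mem_ofPred_eq] at hv
      simp only [Finset.coe_product, Set.mem_prod, Finset.mem_coe, Finset.mem_filter,
        Finset.mem_range]
      refine ⟨⟨hv.2, ?_⟩, ?_⟩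
      · have := (hS v).1 hv.1
        cases v with
        | short k i j =>
          obtain ⟨-, -, h⟩ := this
          simp only [anchor, layer]
          rw [if_pos (by omega)]
        | _ => simp [anchor, layer]
      · have := (hS v).1 hv.1
        cases v with
        | short k i j =>
          obtain ⟨h1, -, h2⟩ := this
          exact h2.trans h1
        | _ => simp [position]
    · intro u _ v _ h
      exact eq_of_anchor_eq (congrArg Prod.fst h) (congrArg Prod.snd h)
  have h2 : (S.filter fun v => ¬ anchor v ∈ S).card ≤ ((Finset.Ico E (E + 8)).image z).card := by
    refine Finset.card_le_card fun v hv => ?_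
    simp only [Finset.mem_filter, hS] at hv
    obtain ⟨hv, hv'⟩ := hv
    cases v with
    | short k i j =>
      obtain ⟨h1, h2, h3⟩ := hv
      exact absurd ⟨h1, h2, by omega⟩ hv'
    | z t =>
      simp only [anchor, InPiece] at hv hv'
      exact Finset.mem_image_of_mem _ (Finset.mem_Ico.2 ⟨by omega, by omega⟩)
    | _ => exact absurd hv hv'
  have h3 : ((Finset.Ico E (E + 8)).image z).card ≤ 8 :=
    Finset.card_image_le.trans (by simp)
  have h4 := Finset.card_filter_add_card_filter_not (s := S) (fun v => anchor v ∈ S)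
  rw [Finset.card_product, Finset.card_range] at h1
  omega

/-- There are only polynomially many pieces with `n` vertices. -/
theorem exists_enumeration_isPiece (n : ℕ) :
    ∃ F : ((Fin 72 → Fin (n + 1)) × Fin (n + 1) × Fin (n + 1)) → Finset ChainVertex,
      ∀ S, IsPiece S → S.card = n → S ∈ Set.range F := by
  classical
  refine ⟨fun q => if h : ∃ S : Finset ChainVertex, ∀ v, v ∈ S ↔
      InPiece (fun k => if h : k < 72 then q.1 ⟨k, h⟩ else 0) q.2.1 q.2.2 v then h.choose else ∅, ?_⟩
  rintro S ⟨m, E, W, -, hS⟩ hn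
  have hle : ∀ (a : ℕ) (f : ℕ → ChainVertex), Function.Injective f → (∀ i < a, f i ∈ S) →
      a < n + 1 := by
    intro a f hf h
    have := Finset.card_le_card_of_injOn (s := Finset.range a) f (fun i hi => h i (by simpa using hi))
      hf.injOn
    rw [Finset.card_range, hn] at this
    omega
  -- Cycles of length 0 have no vertices, so `m 0` is not bounded by n; it is replaced by 0 without
  -- changing the piece.
  have hm : ∀ k : Fin 72, (if (k : ℕ) = 0 then 0 else m k) < n + 1 := by
    intro k
    split_ifs with h
    · omega
    · exact hle _ (fun i => short k i 0) (fun i j h => by simpa using h)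
        (fun i hi => (hS _).2 ⟨k.2, hi, by omega⟩)
  have hE : E < n + 1 := hle _ x₀ (fun i j h => by simpa using h) (fun i hi => (hS _).2 hi)
  have hW : W < n + 1 := hle _ z (fun i j h => by simpa using h) (fun i hi => (hS _).2 hi)
  refine ⟨⟨fun k => ⟨_, hm k⟩, ⟨E, hE⟩, ⟨W, hW⟩⟩, ?_⟩
  have hS' : ∀ v, v ∈ S ↔ InPiece (fun k => if h : k < 72 then
      ((⟨if k = 0 then 0 else m k, hm ⟨k, h⟩⟩ : Fin (n + 1)) : ℕ) else 0) E W v := by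
    intro v
    rw [hS]
    cases v with
    | short k i j =>
      simp only [InPiece]
      refine and_congr_right fun hk => ?_
      rw [dif_pos hk]
      rcases Nat.eq_zero_or_pos k with rfl | h0
      · simp
      · rw [if_neg (by omega)]
    | _ => exact Iff.rfl
  beta_reduce
  have hex : ∃ S : Finset ChainVertex, ∀ v, v ∈ S ↔ InPiece (fun k => if h : k < 72 then
      ((⟨if k = 0 then 0 else m k, hm ⟨k, h⟩⟩ : Fin (n + 1)) : ℕ) else 0) E W v := ⟨S, hS'⟩
  rw [dif_pos hex]
  ext v
  rw [hex.choose_spec, hS']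

end ChainVertex

/-! ### Union bound and choice of the constant -/

open MeasureTheory ChainVertex unitInterval

/-- Take q = 1 - (1 - p)^(1/r); the lower bound on q is Bernoulli's inequality. -/
theorem exists_symm_pow_eq (p : unitInterval) {r : ℕ} (hr : r ≠ 0) :
    ∃ q : unitInterval, σ q ^ r = σ p ∧ (p : ℝ) / r ≤ q := by
  have hp0 : (0 : ℝ) ≤ 1 - p := sub_nonneg.2 p.2.2
  set x : ℝ := (1 - p : ℝ) ^ ((r : ℝ)⁻¹) with hx
  have hx0 : 0 ≤ x := Real.rpow_nonneg hp0 _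
  have hx1 : x ≤ 1 := Real.rpow_le_one hp0 (by linarith [p.2.1]) (by positivity)
  have hxr : x ^ r = 1 - p := Real.rpow_inv_natCast_pow hp0 hr
  refine ⟨⟨1 - x, by linarith, by linarith⟩, ?_, ?_⟩
  · ext
    simp [hxr]
  · have h := one_add_mul_le_pow (a := x - 1) (by linarith) r
    have hr' : (0 : ℝ) < r := by positivity
    rw [div_le_iff₀ hr']
    rw [add_sub_cancel, hxr] at h
    simp only
    linarith

theorem isUniversalFor_of_forall_embeds {n : ℕ} {G : SimpleGraph (Fin n)}
    (hG : ∀ S, IsPiece S → S.card = n → Embeds S G) :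
    IsUniversalFor (boundedDegreeFamily n 2) G := by
  classical
  intro H hH
  refine isContained_of_forall_embeds (fun v a b c ha hb hc => ?_) hG
  by_contra! hne
  have h1 : ({a, b, c} : Finset (Fin n)) ⊆ H.neighborFinset v := by
    intro x hx
    simp only [Finset.mem_insert, Finset.mem_singleton] at hx
    rw [SimpleGraph.mem_neighborFinset]
    rcases hx with rfl | rfl | rfl <;> assumption
  have h2 := Finset.card_le_card h1
  rw [Finset.card_eq_three.2 ⟨a, b, c, hne.1, hne.2.2, hne.2.1, rfl⟩,
    SimpleGraph.card_neighborFinset_eq_degree] at h2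
  have h3 := H.degree_le_maxDegree v
  have h4 : H.maxDegree ≤ 2 := by
    have h5 := hH
    simp only [boundedDegreeFamily, Set.mem_ofPred_eq] at h5
    convert h5
  omega

theorem binomialRandom_not_isUniversalFor_le {n : ℕ} (hn : 9 ≤ n) (p q : unitInterval)
    (hq : σ q ^ 72 = σ p) :
    SimpleGraph.binomialRandom (Fin n) p
        {G | ¬ IsUniversalFor (boundedDegreeFamily n 2) G} ≤
      ENNReal.ofReal ((n + 1) ^ 74 * (72 * (n ^ 3 * Real.exp (-((q : ℝ) ^ 2 * (n / 80) / 2))))) := by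
  classical
  obtain ⟨F, hF⟩ := exists_enumeration_isPiece n
  have : Nonempty (Fin n) := ⟨⟨0, by omega⟩⟩
  have hp : p = σ (σ q ^ (71 + 1)) := by rw [hq, symm_symm]
  set δ : ℝ := n ^ 3 * Real.exp (-((q : ℝ) ^ 2 * (n / 80) / 2)) with hδ
  have hS : ∀ S, IsPiece S → S.card = n →
      SimpleGraph.binomialRandom (Fin n) p {G | ¬ Embeds S G} ≤ ENNReal.ofReal (72 * δ) := by
    intro S hS hn'
    have hL := hS.card_le
    have key := SimpleGraph.binomialRandom_not_exists_embedsBelow_le (V := Fin n) (S := S)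
      (down := down) (layer := layer) q (t := 71)
      (fun _ _ => layer_lt_of_mem_down) card_down_le_two (fun _ _ _ => eq_of_mem_down)
      (by simpa using hn') le_rfl le_rfl
    rw [← hp] at key
    refine (measure_mono ?_).trans (key.trans ?_)
    · rintro G hG ⟨f, hf, hfG⟩
      obtain ⟨m, E, W, -, hmem⟩ := hS
      have hlay : ∀ u ∈ S, layer u < 72 := fun u hu => layer_lt_of_inPiece ((hmem u).1 hu)
      exact hG ⟨f, fun u hu v hv h => hf ⟨hu, hlay u hu⟩ ⟨hv, hlay v hv⟩ h,
        fun u hu v hv => hfG u hu (hlay u hu) v hv⟩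
    · rw [ENNReal.ofReal_mul (p := 72) (by norm_num)]
      have h72 : ((71 + 1 : ℕ) : ENNReal) ≤ ENNReal.ofReal 72 := by norm_num
      refine mul_le_mul' h72 (ENNReal.ofReal_le_ofReal ?_)
      rw [hδ, Fintype.card_fin]
      -- As n ≥ 9, the top layer has T ≥ 1 vertices, so 72 T + 8 ≤ 80 T.
      have : n ≤ 80 * (S.filter fun v => 71 ≤ layer v).card := by omega
      have h80 : (n : ℝ) / 80 ≤ (S.filter fun v => 71 ≤ layer v).card := by
        rw [div_le_iff₀ (by norm_num)]
        exact_mod_cast (this.trans_eq (mul_comm _ _))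
      gcongr
  have hsub : {G | ¬ IsUniversalFor (boundedDegreeFamily n 2) G} ⊆
      ⋃ x, {G : SimpleGraph (Fin n) | (IsPiece (F x) ∧ (F x).card = n) ∧ ¬ Embeds (F x) G} := by
    intro G hG
    by_contra hcon
    refine hG (isUniversalFor_of_forall_embeds fun S h1 h2 => ?_)
    by_contra h3
    obtain ⟨x, rfl⟩ := hF S h1 h2
    exact hcon (Set.mem_iUnion.2 ⟨x, ⟨h1, h2⟩, h3⟩)
  refine (measure_mono hsub).trans ((measure_iUnion_fintype_le _ _).trans ?_)
  refine (Finset.sum_le_card_nsmul _ _ (ENNReal.ofReal (72 * δ)) fun x _ => ?_).trans ?_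
  · by_cases hx : IsPiece (F x) ∧ (F x).card = n
    · exact (measure_mono fun G hG => hG.2).trans (hS _ hx.1 hx.2)
    · simp [hx]
  · rw [Finset.card_univ, nsmul_eq_mul,
      ENNReal.ofReal_mul (p := ((n : ℝ) + 1) ^ 74) (by positivity)]
    refine mul_le_mul' ?_ le_rfl
    simp only [Fintype.card_prod, Fintype.card_fun, Fintype.card_fin]
    rw [← ENNReal.ofReal_natCast]
    refine ENNReal.ofReal_le_ofReal (le_of_eq ?_)
    push_cast
    ring

theorem mainTheorem1 :
    ∃ C : ℝ, 0 < C ∧ ∀ p : ℕ → unitInterval,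
      (∀ᶠ n : ℕ in atTop, C * (Real.log (n : ℝ) / (n : ℝ)) ^ (1 / 2 : ℝ) ≤ (p n : ℝ)) →
        RandomGraphAAS p (fun n G => IsUniversalFor (boundedDegreeFamily n 2) G) := by
  -- 8640 = 72 * 120: then q ≥ 120 (log n / n)^(1/2), and q^2 (n / 80) / 2 ≥ 90 log n. The resulting
  -- n^(-90) beats the factor n^(74 + 3).
  refine ⟨8640, by norm_num, fun p hp => ?_⟩
  have hbad : Tendsto (fun n : ℕ => SimpleGraph.binomialRandom (Fin n) (p n)
      {G | ¬ IsUniversalFor (boundedDegreeFamily n 2) G}) atTop (𝓝 0) := by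
    have hlim : Tendsto (fun n : ℕ => ENNReal.ofReal (2 ^ 74 * 72 * (1 / (n : ℝ)))) atTop (𝓝 0) := by
      rw [← ENNReal.ofReal_zero]
      refine ENNReal.tendsto_ofReal ?_
      simpa using tendsto_one_div_atTop_nhds_zero_nat.const_mul (2 ^ 74 * 72 : ℝ)
    refine tendsto_of_tendsto_of_tendsto_of_le_of_le' tendsto_const_nhds hlim
      (Eventually.of_forall fun _ => zero_le) ?_
    filter_upwards [hp, eventually_ge_atTop 9] with n hpn hn
    obtain ⟨q, hq, hpq⟩ := exists_symm_pow_eq (p n) (r := 72) (by norm_num)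
    refine (binomialRandom_not_isUniversalFor_le hn (p n) q hq).trans (ENNReal.ofReal_le_ofReal ?_)
    have hn1 : (1 : ℝ) ≤ n := by exact_mod_cast (by omega : 1 ≤ n)
    have hn0 : (0 : ℝ) < n := by linarith
    have hlog : 0 ≤ Real.log n := Real.log_nonneg hn1
    have hq2 : 14400 * (Real.log n / n) ≤ (q : ℝ) ^ 2 := by
      have h1 : 120 * Real.sqrt (Real.log n / n) ≤ q := by
        rw [← Real.sqrt_eq_rpow] at hpn
        push_cast at hpq
        linarith
      calc 14400 * (Real.log n / n) = (120 * Real.sqrt (Real.log n / n)) ^ 2 := by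
            rw [mul_pow, Real.sq_sqrt (by positivity)]; norm_num
        _ ≤ _ := by gcongr
    have hexp : Real.exp (-((q : ℝ) ^ 2 * (n / 80) / 2)) ≤ 1 / (n : ℝ) ^ 90 := by
      calc Real.exp (-((q : ℝ) ^ 2 * (n / 80) / 2)) ≤ Real.exp (-(90 * Real.log n)) := by
            refine Real.exp_le_exp.2 (neg_le_neg ?_)
            calc 90 * Real.log n = 14400 * (Real.log n / n) * (n / 80) / 2 := by
                  field_simp; ring
              _ ≤ _ := by gcongr
        _ = 1 / (n : ℝ) ^ 90 := by
            rw [Real.exp_neg, one_div, mul_comm, Real.exp_mul, Real.exp_log hn0]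
            norm_cast
    calc ((n : ℝ) + 1) ^ 74 * (72 * (n ^ 3 * Real.exp (-((q : ℝ) ^ 2 * (n / 80) / 2))))
        ≤ (2 * n) ^ 74 * (72 * (n ^ 3 * (1 / (n : ℝ) ^ 90))) := by
          gcongr
          linarith
      _ = 2 ^ 74 * 72 * (1 / (n : ℝ) ^ 13) := by
          field_simp
      _ ≤ 2 ^ 74 * 72 * (1 / (n : ℝ)) := by
          gcongr
          exact le_self_pow₀ hn1 (by norm_num)
  have h := ENNReal.Tendsto.sub tendsto_const_nhds hbad (Or.inl ENNReal.one_ne_top)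
  rw [tsub_zero] at h
  refine h.congr fun n => ?_
  rw [← prob_compl_eq_one_sub (Set.toFinite _).measurableSet]
  congr 1
  ext G
  simp
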